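/- Let $X$ and $H$ be self-adjoint complex $m\times m$ matrices and let $S=\sigma(X)\subset\mathbb{R}$ be the spectrum of $X$. Let $D([0,1],S)$ be the Skorokhod space of right-continuous functions $[0,1]\to S$ with left limits, with the Skorokhod ($J_1$) topology, i.e. the topology of the metric $d(\xi,\eta)=\inf_{\varphi}\max\{\sup_t|\varphi(t)-t|,\ \sup_t|\xi(t)-\eta(\varphi(t))|\}$, where $\varphi$ runs over the increasing bijections of $[0,1]$, and with its Borel $\sigma$-algebra. For $A\subset S$ let $P_A=1_A(X)$ be the spectral projection of $X$ corresponding to $A$. There exists a complex-valued bounded Radon measure $\kappa$ on $D([0,1],S)$ (that is, a complex Borel measure whose total variation measure $|\kappa|$ is finite and inner regular with respect to compact sets) such that: (i) for all $N\ge 1$, all $0\le t_1<\dots<t_N\le 1$ and all Borel sets $A_1,\dots,A_N\subset S$, the set $\{\xi:\ \xi(t_i)\in A_i\ (i=1,\dots,N)\}$ is Borel and $$\kappa\big(\xi(t_i)\in A_i\ (i=1,\dots,N)\big)=\operatorname{Tr}\left[e^{-(1-t_N)H}P_{A_N}e^{-(t_N-t_{N-1})H}P_{A_{N-1}}\cdots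 P_{A_2}e^{-(t_2-t_1)H}P_{A_1}e^{-t_1H}\right];$$ (ii) for every continuous $f:S\to\mathbb{R}$, the function $t\mapsto f(\eta(t))$ is integrable on $[0,1]$ for every $\eta\in D([0,1],S)$, the function $\eta\mapsto\exp\left(\int_0^1 f(\eta(t))\,dt\right)$ is $|\kappa|$-integrable, and the Feynman–Kac type formula $$\operatorname{Tr}\,e^{f(X)-H}=\int_{D([0,1],S)}\exp\left(\int_0^1 f(\eta(t))\,dt\right)\kappa(d\eta)$$ holds. -/

import Mathlib

open MeasureTheory Filter Topology
open scoped unitInterval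

namespace QSP

/-- The Skorokhod space `D([0,1], E)` as a set: the functions `[0,1] → E` that are right-continuous
and have left limits. At `t = 1` right-continuity is void, and at `t = 0` the existence of a left
limit is void. -/
structure SkorokhodSpace (E : Type*) [TopologicalSpace E] where
  /-- The underlying path. -/
  path : I → E
  right_continuous : ∀ t, ContinuousWithinAt path (Set.Ici t) t
  left_limit : ∀ t, ∃ l, Tendsto path (𝓝[<] t) (𝓝 l)

namespace SkorokhodSpace

instance {E : Type*} [TopologicalSpace E] : CoeFun (SkorokhodSpace E) (fun _ => I → E) :=
  ⟨path⟩

variable {E : Type*} [PseudoEMetricSpace E]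

/-- The Skorokhod distance
`d(ξ, η) = inf_φ max (sup_t |φ(t) - t|) (sup_t d(ξ(t), η(φ(t))))`,
the infimum being over all increasing bijections `φ` of `[0,1]` onto itself (these are
automatically homeomorphisms). -/
noncomputable instance : EDist (SkorokhodSpace E) :=
  ⟨fun ξ η => ⨅ φ : I ≃o I, max (⨆ t, edist (φ t) t) (⨆ t, edist (ξ t) (η (φ t)))⟩

theorem edist_def (ξ η : SkorokhodSpace E) :
    edist ξ η = ⨅ φ : I ≃o I, max (⨆ t, edist (φ t) t) (⨆ t, edist (ξ t) (η (φ t))) := rfl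

theorem edist_comm_le (ξ η : SkorokhodSpace E) : edist ξ η ≤ edist η ξ := by
  rw [edist_def η ξ]
  refine le_iInf fun φ => (iInf_le _ φ.symm).trans (max_le_max ?_ ?_)
  · refine iSup_le fun t => ?_
    have := le_iSup (fun t => edist (φ t) t) (φ.symm t)
    simpa [edist_comm] using this
  · refine iSup_le fun t => ?_
    have := le_iSup (fun t => edist (η t) (ξ (φ t))) (φ.symm t)
    simpa [edist_comm] using this

/-- The Skorokhod (J1) topology, as the topology of the Skorokhod distance. -/
noncomputable instance : PseudoEMetricSpace (SkorokhodSpace E) where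
  edist_self ξ := by
    refine le_antisymm ((iInf_le _ (OrderIso.refl I)).trans ?_) bot_le
    simp
  edist_comm ξ η := le_antisymm (edist_comm_le ξ η) (edist_comm_le η ξ)
  edist_triangle ξ η ζ := by
    rw [edist_def ξ η, edist_def η ζ]
    refine ENNReal.le_iInf_add_iInf fun φ ψ => (iInf_le _ (φ.trans ψ)).trans (max_le ?_ ?_)
    · refine iSup_le fun t => (edist_triangle _ (φ t) _).trans ?_
      rw [add_comm]
      exact add_le_add ((le_iSup (fun t => edist (φ t) t) t).trans (le_max_left _ _))
        ((le_iSup (fun t => edist (ψ t) t) (φ t)).trans (le_max_left _ _))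
    · refine iSup_le fun t => (edist_triangle _ (η (φ t)) _).trans ?_
      exact add_le_add
        ((le_iSup (fun t => edist (ξ t) (η (φ t))) t).trans (le_max_right _ _))
        ((le_iSup (fun t => edist (η t) (ζ (ψ t))) (φ t)).trans (le_max_right _ _))

/-- The Skorokhod space carries the Borel σ-algebra of the Skorokhod topology. -/
noncomputable instance : MeasurableSpace (SkorokhodSpace E) := borel _

instance : BorelSpace (SkorokhodSpace E) := ⟨rfl⟩

end SkorokhodSpace

/-- A complex measure `κ` on the Borel sets of a topological space is a bounded Radon measure if
its total variation `|κ|` is finite and is inner regular with respect to compact sets. -/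
structure IsBoundedRadon {Ω : Type*} [TopologicalSpace Ω] [MeasurableSpace Ω]
    (κ : ComplexMeasure Ω) : Prop where
  finite : IsFiniteMeasure κ.variation
  innerRegular : κ.variation.InnerRegular

variable {m : ℕ}

/-- The spectral projection `P_A = 1_A(X)` of a self-adjoint matrix `X`, for `A ⊆ σ(X)`. -/
noncomputable def spectralProj (X : Matrix (Fin m) (Fin m) ℂ) (A : Set (spectrum ℝ X)) :
    Matrix (Fin m) (Fin m) ℂ :=
  cfc (Set.indicator (Subtype.val '' A) (fun _ : ℝ => (1 : ℝ))) X

/-- The heat semigroup `e^{-sH}`. -/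
noncomputable def semigroup (H : Matrix (Fin m) (Fin m) ℂ) (s : ℝ) : Matrix (Fin m) (Fin m) ℂ :=
  NormedSpace.exp (-(s • H))

/-- The product
`e^{-(1-t_N)H} P_{A_N} e^{-(t_N-t_{N-1})H} P_{A_{N-1}} ⋯ P_{A_2} e^{-(t_2-t_1)H} P_{A_1} e^{-t_1 H}`
for `N = n + 1` times, indexed from `0` to `n`. The factor with index `i` is
`P_{A_i} e^{-(t_i - t_{i-1})H}`, where the time preceding the first one is `0`; factors with larger
index stand further to the left. -/
noncomputable def pathProduct (X H : Matrix (Fin m) (Fin m) ℂ) {n : ℕ} (t : Fin (n + 1) → ℝ)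
    (A : Fin (n + 1) → Set (spectrum ℝ X)) : Matrix (Fin m) (Fin m) ℂ :=
  semigroup H (1 - t (Fin.last n)) *
    (List.ofFn fun i : Fin (n + 1) =>
      spectralProj X (A i) *
        semigroup H (t i - (Fin.cons 0 t : Fin (n + 2) → ℝ) i.castSucc)).reverse.prod

end QSP

/-! Write `K = -H` and let `P a` be the spectral projections of `X`. In the series of `exp K`, a
resolution of the identity placed around every factor `K` turns `K ^ k` into the sum over words `a
0, …, a k` of `P (a k) * K * ⋯ * K * P (a 0)`. Each word is read as a path: it visits `a 0, …, a k`
in turn and jumps at `k` independent uniform times, put in order. The measure `κ` is the sum of the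
laws of these paths with weights `1 / k!` times the trace of the word (`dysonMeasure`). The
factorial beats the number of words, so the total variation is finite; the paths depend continuously
on their jump times off a null set, so `κ` is Radon.

For the marginals, only the numbers of jump times between consecutive `t i` matter. With these
numbers fixed, the constrained sum over words collapses to powers of `K` interlaced with the
projections `P_{A_i}` (`sum_word_eq_blockProd`). Averaging over uniform jump times produces
multinomial weights, which reassemble one exponential series for each gap
(`hasSum_sum_blockProd_counts`).

For the Feynman–Kac formula, the exponential of a Riemann sum depends on finitely many evaluations,
so the marginals integrate it to the trace of a Lie–Trotter product (`integral_exp_riemannSum`).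
Refining the partition gives the formula, by dominated convergence on path space and the Lie product
formula for matrices. -/

namespace QSP

/-! ### Complex measures as weighted sums of probability measures -/

section WeightedSum

variable {Ω ι : Type*} [MeasurableSpace Ω]

/-- Countable additivity is an exchange of two sums, justified because the double family is
dominated by `‖w i‖` after summing over `n`. -/
theorem hasSum_weighted_measureReal_iUnion (ν : ι → Measure Ω) [∀ i, IsProbabilityMeasure (ν i)]
    (w : ι → ℂ) (hw : Summable fun i => ‖w i‖) (B : ℕ → Set Ω) (hB : ∀ n, MeasurableSet (B n))
    (hd : Pairwise (Function.onFun Disjoint B)) :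
    HasSum (fun n => ∑' i, w i * ((ν i).real (B n) : ℂ))
      (∑' i, w i * ((ν i).real (⋃ n, B n) : ℂ)) := by
  have hreal : ∀ i, HasSum (fun n => (ν i).real (B n)) ((ν i).real (⋃ n, B n)) := fun i => by
    have h := (measure_iUnion hd hB : (ν i) (⋃ n, B n) = _)
    have h2 := ENNReal.hasSum_toReal (f := fun n => ν i (B n)) (by rw [← h]; finiteness)
    rw [← ENNReal.tsum_toReal_eq (fun n => by finiteness), ← h] at h2
    exact h2
  have hn : Summable fun p : ι × ℕ => ‖w p.1 * ((ν p.1).real (B p.2) : ℂ)‖ := by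
    rw [summable_prod_of_nonneg (fun _ => norm_nonneg _)]
    simp only [norm_mul, Complex.norm_real, Real.norm_eq_abs, abs_of_nonneg measureReal_nonneg]
    refine ⟨fun i => (hreal i).summable.mul_left _, ?_⟩
    refine hw.of_nonneg_of_le (fun i => tsum_nonneg fun n => by positivity) fun i => ?_
    rw [tsum_mul_left, (hreal i).tsum_eq]
    exact mul_le_of_le_one_right (norm_nonneg _) measureReal_le_one
  have hs : Summable fun p : ι × ℕ => w p.1 * ((ν p.1).real (B p.2) : ℂ) := hn.of_norm
  have h1 : HasSum (fun p : ι × ℕ => w p.1 * ((ν p.1).real (B p.2) : ℂ))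
      (∑' i, w i * ((ν i).real (⋃ n, B n) : ℂ)) := by
    have h3 := hs.hasSum.prod_fiberwise (g := fun i => w i * ((ν i).real (⋃ n, B n) : ℂ))
      (fun i => (Complex.hasSum_ofReal.2 (hreal i)).mul_left _)
    rw [h3.tsum_eq]
    exact hs.hasSum
  have h2 : HasSum (fun p : ℕ × ι => w p.2 * ((ν p.2).real (B p.1) : ℂ))
      (∑' i, w i * ((ν i).real (⋃ n, B n) : ℂ)) :=
    (Equiv.prodComm ℕ ι).hasSum_iff.2 h1
  exact h2.prod_fiberwise fun n => (hs.comp_injective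
    (i := fun i => (i, n)) fun a b h => by simpa using h).hasSum

open scoped Classical in
/-- The complex measure `∑ wᵢ νᵢ` for probability measures `νᵢ` and summable weights `wᵢ`. -/
noncomputable def weightedSum (ν : ι → Measure Ω) [∀ i, IsProbabilityMeasure (ν i)]
    (w : ι → ℂ) (hw : Summable fun i => ‖w i‖) : ComplexMeasure Ω where
  measureOf' B := if MeasurableSet B then ∑' i, w i * ((ν i).real B : ℂ) else 0
  empty' := by simp
  not_measurable' B hB := by simp [hB]
  m_iUnion' B hB hd := by
    simp only [hB, MeasurableSet.iUnion hB, if_true]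
    exact hasSum_weighted_measureReal_iUnion ν w hw B hB hd

variable (ν : ι → Measure Ω) [∀ i, IsProbabilityMeasure (ν i)]
    (w : ι → ℂ) (hw : Summable fun i => ‖w i‖)

theorem weightedSum_apply {B : Set Ω} (hB : MeasurableSet B) :
    weightedSum ν w hw B = ∑' i, w i * ((ν i).real B : ℂ) := if_pos hB

theorem summable_weighted_measureReal {w : ι → ℂ} (hw : Summable fun i => ‖w i‖) (B : Set Ω) :
    Summable fun i => ‖w i * ((ν i).real B : ℂ)‖ := by
  refine hw.of_nonneg_of_le (fun _ => norm_nonneg _) fun i => ?_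
  rw [norm_mul, Complex.norm_real, Real.norm_eq_abs, abs_of_nonneg measureReal_nonneg]
  exact mul_le_of_le_one_right (norm_nonneg _) measureReal_le_one

theorem variation_weightedSum_le :
    (weightedSum ν w hw).variation ≤ Measure.sum fun i => ‖w i‖ₑ • ν i := by
  refine VectorMeasure.variation_le_of_forall_enorm_le fun B hB => ?_
  rw [weightedSum_apply ν w hw hB, Measure.sum_apply _ hB]
  refine (enorm_tsum_le_tsum_enorm).trans (ENNReal.tsum_le_tsum fun i => ?_)
  rw [enorm_mul, Measure.smul_apply, smul_eq_mul]
  gcongr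
  rw [← ofReal_norm, Complex.norm_real, Real.norm_eq_abs, abs_of_nonneg measureReal_nonneg]
  simp

/-- A compact subset of `B` that misses little `μ`-mass misses at most as much `ν`-mass. -/
theorem innerRegular_of_le [TopologicalSpace Ω] {μ ν : Measure Ω} [IsFiniteMeasure μ]
    [μ.InnerRegular] [BorelSpace Ω] [R1Space Ω] (h : ν ≤ μ) : ν.InnerRegular := by
  have : IsFiniteMeasure ν := isFiniteMeasure_of_le μ h
  refine ⟨fun B hB r hr => ?_⟩
  obtain ⟨K, hKB, hK, hKc, hlt⟩ := hB.exists_isCompact_isClosed_lt_add (μ := μ) (by finiteness)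
    (ε := ν B - r) (tsub_pos_of_lt hr).ne'
  refine ⟨K, hKB, hK, ?_⟩
  have h1 : ν (B \ K) < ν B - r :=
    (h _).trans_lt (measure_sdiff_lt_of_lt_add hKc.measurableSet.nullMeasurableSet hKB
      (by finiteness) hlt)
  by_contra! h2
  have h3 : ν B ≤ ν K + ν (B \ K) := by
    have := measure_union_le (μ := ν) K (B \ K)
    rwa [Set.union_sdiff_cancel hKB] at this
  have h4 : ν K + ν (B \ K) < r + (ν B - r) := by
    exact ENNReal.add_lt_add_of_le_of_lt (by finiteness) h2 h1
  rw [add_tsub_cancel_of_le hr.le] at h4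
  exact absurd (h3.trans_lt h4) (lt_irrefl _)

theorem isBoundedRadon_weightedSum [TopologicalSpace Ω] [BorelSpace Ω] [R1Space Ω]
    [∀ i, (ν i).InnerRegular] : IsBoundedRadon (weightedSum ν w hw) := by
  have : IsFiniteMeasure (Measure.sum fun i => ‖w i‖ₑ • ν i) := by
    refine ⟨?_⟩
    simp only [Measure.sum_apply _ MeasurableSet.univ, Measure.smul_apply, measure_univ,
      smul_eq_mul, mul_one]
    have := hw.tsum_ofReal_lt_top
    simpa only [ofReal_norm] using this
  exact ⟨isFiniteMeasure_of_le _ (variation_weightedSum_le ν w hw),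
    innerRegular_of_le (variation_weightedSum_le ν w hw)⟩

end WeightedSum

/-! ### Measurability of evaluations for a finite state space -/

section Evaluation

variable {S : Type*} [EMetricSpace S] [Finite S]

/-- Because of this gap, two paths at Skorokhod distance below `δ` are exact time changes of each
other. -/
theorem exists_pos_forall_edist_lt_imp_eq (S : Type*) [EMetricSpace S] [Finite S] :
    ∃ δ : ENNReal, 0 < δ ∧ ∀ a b : S, edist a b < δ → a = b := by
  classical
  have := Fintype.ofFinite S
  rcases (Finset.univ.offDiag : Finset (S × S)).eq_empty_or_nonempty with h | h
  · refine ⟨1, one_pos, fun a b _ => ?_⟩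
    by_contra hab
    have : (a, b) ∈ (Finset.univ.offDiag : Finset (S × S)) := by simp [hab]
    simp [h] at this
  · obtain ⟨p, hp, hmin⟩ := Finset.exists_min_image _ (fun p : S × S => edist p.1 p.2) h
    refine ⟨edist p.1 p.2, edist_pos.2 (by simpa using hp), fun a b hab => ?_⟩
    by_contra hne
    exact absurd hab (not_lt.2 (hmin (a, b) (by simp [hne])))

theorem SkorokhodSpace.exists_orderIso_of_edist_lt {E : Type*} [PseudoEMetricSpace E]
    {ξ η : SkorokhodSpace E} {ε : ENNReal} (h : edist ξ η < ε) :
    ∃ φ : I ≃o I, (∀ u, edist (φ u) u < ε) ∧ ∀ u, edist (ξ u) (η (φ u)) < ε := by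
  rw [SkorokhodSpace.edist_def, iInf_lt_iff] at h
  obtain ⟨φ, hφ⟩ := h
  rw [max_lt_iff] at hφ
  exact ⟨φ, fun u => (le_iSup (fun t => edist (φ t) t) u).trans_lt hφ.1,
    fun u => (le_iSup (fun t => edist (ξ t) (η (φ t))) u).trans_lt hφ.2⟩

/-- Evaluation at `p` need not be continuous, but constancy on a ball around `p` survives, on the
ball of half the radius, under a time change moving points by less than the other half. -/
theorem isOpen_setOf_eventually_eq (p : I) (a : S) :
    IsOpen {ξ : SkorokhodSpace S | ∀ᶠ u in 𝓝 p, ξ u = a} := by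
  obtain ⟨δ, hδ, hδS⟩ := exists_pos_forall_edist_lt_imp_eq S
  rw [EMetric.isOpen_iff]
  intro ξ hξ
  obtain ⟨r, hr, hball⟩ := EMetric.mem_nhds_iff.1 (show {u | ξ u = a} ∈ 𝓝 p from hξ)
  refine ⟨min δ (r / 2), lt_min hδ (ENNReal.half_pos hr.ne'), fun η hη => ?_⟩
  rw [Metric.mem_eball, edist_comm] at hη
  obtain ⟨φ, h1, h2⟩ := SkorokhodSpace.exists_orderIso_of_edist_lt hη
  refine mem_of_superset (Metric.eball_mem_nhds p (ENNReal.half_pos hr.ne')) fun u hu => ?_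
  have h3 := hδS _ _ ((h2 (φ.symm u)).trans_le (min_le_left _ _))
  have h4 := (h1 (φ.symm u)).trans_le (min_le_right _ _)
  rw [φ.apply_symm_apply] at h3 h4
  have h5 : φ.symm u ∈ Metric.eball p r := by
    rw [Metric.mem_eball]
    calc edist (φ.symm u) p ≤ edist u (φ.symm u) + edist u p := edist_triangle_left _ _ _
      _ < r / 2 + r / 2 := ENNReal.add_lt_add h4 hu
      _ = r := ENNReal.add_halves r
  exact h3.symm.trans (hball h5)

/-- Every time change fixes the endpoint `1`, so evaluation there is locally constant. -/
theorem isOpen_setOf_eval_one_eq (a : S) : IsOpen {ξ : SkorokhodSpace S | ξ 1 = a} := by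
  obtain ⟨δ, hδ, hδS⟩ := exists_pos_forall_edist_lt_imp_eq S
  rw [EMetric.isOpen_iff]
  intro ξ hξ
  refine ⟨δ, hδ, fun η hη => ?_⟩
  rw [Metric.mem_eball, edist_comm] at hη
  obtain ⟨φ, -, h2⟩ := SkorokhodSpace.exists_orderIso_of_edist_lt hη
  have h1 : φ 1 = 1 := φ.map_top
  have := hδS _ _ (h2 1)
  rw [h1] at this
  exact this.symm.trans hξ

/-- For `t < 1`, right-continuity into a discrete space makes `ξ` constant on some `[t, q)`. Hence
`ξ t` is detected by the open conditions at points `p k` decreasing strictly to `t`. -/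
theorem measurableSet_setOf_eval_eq (t : I) (a : S) :
    MeasurableSet {ξ : SkorokhodSpace S | ξ t = a} := by
  rcases eq_or_lt_of_le (show t ≤ 1 from t.2.2 ) with rfl | ht
  · exact (isOpen_setOf_eval_one_eq a).measurableSet
  obtain ⟨p, -, hp, hlim⟩ := exists_seq_strictAnti_tendsto' ht
  have key : {ξ : SkorokhodSpace S | ξ t = a} =
      ⋃ n, ⋂ k ≥ n, {ξ : SkorokhodSpace S | ∀ᶠ u in 𝓝 (p k), ξ u = a} := by
    ext ξ
    simp only [Set.mem_ofPred_eq, Set.mem_iUnion, Set.mem_iInter]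
    have hrc : Tendsto ξ.path (𝓝[≥] t) (𝓝 (ξ t)) := ξ.right_continuous t
    constructor
    · intro h
      have h1 : ∀ᶠ u in 𝓝[≥] t, ξ u = ξ t :=
        hrc.eventually (p := (· = ξ t)) (by simp [nhds_discrete])
      obtain ⟨q, hq, hsub⟩ := (mem_nhdsGE_iff_exists_Ico_subset' ht).1 h1
      obtain ⟨n, hn⟩ := eventually_atTop.1 (hlim.eventually (gt_mem_nhds hq))
      refine ⟨n, fun k hk => ?_⟩
      filter_upwards [Ioo_mem_nhds (hp k).1 (hn k hk)] with u hu
      exact (hsub ⟨hu.1.le, hu.2⟩).trans h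
    · rintro ⟨n, hn⟩
      have h1 : Tendsto (fun k => ξ (p k)) atTop (𝓝 (ξ t)) :=
        hrc.comp (tendsto_nhdsWithin_iff.2 ⟨hlim, .of_forall fun k => (hp k).1.le⟩)
      refine tendsto_nhds_unique h1 (tendsto_const_nhds.congr' ?_)
      filter_upwards [eventually_ge_atTop n] with k hk
      exact (hn k hk).self_of_nhds.symm
  rw [key]
  exact MeasurableSet.iUnion fun n => MeasurableSet.iInter fun k => MeasurableSet.iInter fun _ =>
    (isOpen_setOf_eventually_eq _ _).measurableSet

theorem measurableSet_setOf_eval_mem (t : I) (A : Set S) :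
    MeasurableSet {ξ : SkorokhodSpace S | ξ t ∈ A} := by
  have : {ξ : SkorokhodSpace S | ξ t ∈ A} = ⋃ a ∈ A, {ξ : SkorokhodSpace S | ξ t = a} := by
    ext; simp
  rw [this]
  exact MeasurableSet.biUnion A.toFinite.countable fun a _ => measurableSet_setOf_eval_eq t a

theorem measurable_comp_eval (t : I) (f : S → ℝ) :
    Measurable fun ξ : SkorokhodSpace S => f (ξ t) := fun B _ =>
  measurableSet_setOf_eval_mem t (f ⁻¹' B)

theorem measurableSet_setOf_forall_eval_mem {n : ℕ} (t : Fin n → I) (A : Fin n → Set S) :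
    MeasurableSet {ξ : SkorokhodSpace S | ∀ i, ξ (t i) ∈ A i} := by
  rw [Set.ofPred_forall]
  exact MeasurableSet.iInter fun i => measurableSet_setOf_eval_mem (t i) (A i)

end Evaluation

/-! ### Riemann sums along a path -/

section RiemannSum

variable {S : Type*} [EMetricSpace S] [Finite S]

/-- The node `(j + 1) / (n + 1)` of the uniform partition of `[0, 1]`. -/
noncomputable def node (n : ℕ) (j : Fin (n + 1)) : I :=
  ⟨((j : ℝ) + 1) / (n + 1), by
    have : (j : ℝ) + 1 ≤ n + 1 := by exact_mod_cast j.2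
    exact ⟨by positivity, by rw [div_le_one (by positivity)]; exact this⟩⟩

theorem node_strictMono (n : ℕ) : StrictMono (node n) := fun i j h => by
  rw [← Subtype.coe_lt_coe]
  simp only [node]
  have : (i : ℝ) < j := by exact_mod_cast h
  gcongr

/-- The right-endpoint Riemann sum of `t ↦ f (η t)`. -/
noncomputable def riemannSum (f : S → ℝ) (n : ℕ) (η : SkorokhodSpace S) : ℝ :=
  ∑ j, f (η (node n j)) / (n + 1)

theorem measurable_riemannSum (f : S → ℝ) (n : ℕ) : Measurable (riemannSum f n) :=
  Finset.measurable_sum _ fun _ _ => (measurable_comp_eval _ f).div_const _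

/-- The ceiling is constant on each cell of the partition. This presents a Riemann sum as an
integral of the path at rounded times, to which dominated convergence applies. -/
theorem integral_ceil (n : ℕ) (h : ℕ → ℝ) :
    ∫ u : I, h ⌈((n : ℝ) + 1) * u⌉₊ = ∑ j ∈ Finset.range (n + 1), h (j + 1) / (n + 1) := by
  have hm : Measurable fun x : ℝ => h ⌈((n : ℝ) + 1) * x⌉₊ :=
    (measurable_from_top (f := h)).comp (Nat.measurable_ceil.comp (measurable_const_mul _))
  have hn : (0 : ℝ) < n + 1 := by positivity
  have hval : ∀ j : ℕ, ∀ x ∈ Set.Ioc ((j : ℝ) / (n + 1)) (((j + 1 : ℕ) : ℝ) / (n + 1)),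
      h ⌈((n : ℝ) + 1) * x⌉₊ = h (j + 1) := fun j x hx => by
    congr 1
    rw [Nat.ceil_eq_iff (by simp)]
    rw [Set.mem_Ioc, div_lt_iff₀ hn, le_div_iff₀ hn] at hx
    push_cast at hx ⊢
    constructor <;> linarith
  have hle : ∀ j : ℕ, (j : ℝ) / (n + 1) ≤ ((j + 1 : ℕ) : ℝ) / (n + 1) := fun j => by
    gcongr; simp
  have hint : ∀ j : ℕ, IntervalIntegrable (fun x : ℝ => h ⌈((n : ℝ) + 1) * x⌉₊) volume
      ((j : ℝ) / (n + 1)) (((j + 1 : ℕ) : ℝ) / (n + 1)) := fun j => by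
    rw [intervalIntegrable_iff, Set.uIoc_of_le (hle j)]
    exact (integrableOn_const (C := h (j + 1)) (by simp)).congr_fun
      (fun x hx => (hval j x hx).symm) measurableSet_Ioc
  calc ∫ u : I, h ⌈((n : ℝ) + 1) * u⌉₊
      = ∫ x in Set.Icc (0 : ℝ) 1, h ⌈((n : ℝ) + 1) * x⌉₊ :=
        integral_subtype_comap measurableSet_Icc (fun x : ℝ => h ⌈((n : ℝ) + 1) * x⌉₊)
    _ = ∫ x in (0 : ℝ)..1, h ⌈((n : ℝ) + 1) * x⌉₊ := by
        rw [integral_Icc_eq_integral_Ioc, intervalIntegral.integral_of_le zero_le_one]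
    _ = ∑ j ∈ Finset.range (n + 1), ∫ x in (j : ℝ) / (n + 1)..((j + 1 : ℕ) : ℝ) / (n + 1),
          h ⌈((n : ℝ) + 1) * x⌉₊ := by
        rw [intervalIntegral.sum_integral_adjacent_intervals
          (a := fun j : ℕ => (j : ℝ) / (n + 1)) fun j _ => hint j]
        simp [div_self hn.ne']
    _ = _ := by
        refine Finset.sum_congr rfl fun j _ => ?_
        rw [intervalIntegral.integral_of_le (hle j),
          setIntegral_congr_fun measurableSet_Ioc (hval j), setIntegral_const,
          Real.volume_real_Ioc_of_le (hle j)]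
        push_cast
        rw [smul_eq_mul]
        ring

/-- Rounding up approaches `u` from the right, the side on which paths are continuous. The rounded
value is already in `[0, 1]`; the projection only supplies the type. -/
theorem tendsto_ceil_div (u : I) :
    Tendsto (fun n : ℕ => Set.projIcc (0 : ℝ) 1 zero_le_one
      ((⌈((n : ℝ) + 1) * u⌉₊ : ℝ) / (n + 1))) atTop (𝓝[≥] u) := by
  have h1 : Tendsto (fun n : ℕ => (⌈((n : ℝ) + 1) * u⌉₊ : ℝ) / (n + 1)) atTop (𝓝 (u : ℝ)) := by
    have h2 := (tendsto_nat_ceil_mul_div_atTop (a := (u : ℝ)) u.2.1).comp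
      (tendsto_atTop_add_const_right atTop (1 : ℝ) tendsto_natCast_atTop_atTop)
    refine h2.congr fun n => ?_
    simp [mul_comm]
  refine tendsto_nhdsWithin_iff.2 ⟨?_, .of_forall fun n => ?_⟩
  · have h2 := ((continuous_projIcc (h := zero_le_one (α := ℝ))).tendsto (u : ℝ)).comp h1
    rwa [Set.projIcc_val] at h2
  · rw [Set.mem_Ici, ← Set.projIcc_val (zero_le_one (α := ℝ)) u]
    refine Set.monotone_projIcc _ ?_
    rw [le_div_iff₀ (by positivity), mul_comm]
    rw [Set.projIcc_val]
    exact Nat.le_ceil _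

theorem tendsto_comp_ceil (f : S → ℝ) (η : SkorokhodSpace S) (u : I) :
    Tendsto (fun n : ℕ => f (η (Set.projIcc (0 : ℝ) 1 zero_le_one
      ((⌈((n : ℝ) + 1) * u⌉₊ : ℝ) / (n + 1))))) atTop (𝓝 (f (η u))) :=
  ((continuous_of_discreteTopology (f := f)).tendsto _).comp
    ((η.right_continuous u).tendsto.comp (tendsto_ceil_div u))

omit [Finite S] in
theorem measurable_comp_ceil (f : S → ℝ) (η : SkorokhodSpace S) (n : ℕ) :
    Measurable (fun u : I => f (η (Set.projIcc (0 : ℝ) 1 zero_le_one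
      ((⌈((n : ℝ) + 1) * u⌉₊ : ℝ) / (n + 1))))) :=
  (measurable_from_top (f := fun k : ℕ => f (η (Set.projIcc (0 : ℝ) 1 zero_le_one
    ((k : ℝ) / (n + 1)))))).comp
      (Nat.measurable_ceil.comp ((measurable_const_mul _).comp measurable_subtype_coe))

omit [EMetricSpace S] in
theorem exists_forall_abs_le (f : S → ℝ) : ∃ C, ∀ a, |f a| ≤ C := by
  obtain ⟨C, hC⟩ := (Set.finite_range fun a => |f a|).bddAbove
  exact ⟨C, fun a => hC ⟨a, rfl⟩⟩

theorem integrable_comp_path (f : S → ℝ) (η : SkorokhodSpace S) :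
    Integrable (fun t : I => f (η t)) volume := by
  obtain ⟨C, hC⟩ := exists_forall_abs_le f
  refine .of_bound (measurable_of_tendsto_metrizable (measurable_comp_ceil f η)
    (tendsto_pi_nhds.2 (tendsto_comp_ceil f η))).aestronglyMeasurable C (.of_forall fun t => hC _)

theorem tendsto_riemannSum (f : S → ℝ) (η : SkorokhodSpace S) :
    Tendsto (fun n => riemannSum f n η) atTop (𝓝 (∫ t : I, f (η t))) := by
  obtain ⟨C, hC⟩ := exists_forall_abs_le f
  have h := tendsto_integral_of_dominated_convergence (μ := (volume : Measure I)) (fun _ => C)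
    (fun n => (measurable_comp_ceil f η n).aestronglyMeasurable) (integrable_const C)
    (fun n => .of_forall fun t => hC _) (.of_forall (tendsto_comp_ceil f η))
  refine h.congr fun n => ?_
  rw [integral_ceil n (fun k => f (η (Set.projIcc (0 : ℝ) 1 zero_le_one ((k : ℝ) / (n + 1))))),
    Finset.sum_range, riemannSum]
  refine Finset.sum_congr rfl fun j _ => ?_
  have : ((j + 1 : ℕ) : ℝ) / (n + 1) = (node n j : ℝ) := by simp [node]
  rw [this, Set.projIcc_val]

omit [Finite S] in
theorem abs_riemannSum_le {f : S → ℝ} {C : ℝ} (hC : ∀ a, |f a| ≤ C) (n : ℕ)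
    (η : SkorokhodSpace S) : |riemannSum f n η| ≤ C := by
  refine (Finset.abs_sum_le_sum_abs _ _).trans ?_
  calc ∑ j : Fin (n + 1), |f (η (node n j)) / (n + 1)| ≤ ∑ j : Fin (n + 1), C / (n + 1) := by
        refine Finset.sum_le_sum fun j _ => ?_
        rw [abs_div, abs_of_pos (by positivity : (0 : ℝ) < n + 1)]
        gcongr
        exact hC _
    _ = C := by
        rw [Finset.sum_const, Finset.card_univ, Fintype.card_fin, nsmul_eq_mul]
        push_cast
        field_simp

end RiemannSum

/-! ### Time changes that move finitely many points -/

section TimeChange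

/-- A piecewise linear time change of `[0, 1]` moving finitely many interior points to prescribed
nearby positions. -/
theorem eventually_exists_orderIso {ι : Type*} [Finite ι] {s₀ : ι → I}
    (hinj : Function.Injective s₀) (h0 : ∀ l, s₀ l ≠ 0) (h1 : ∀ l, s₀ l ≠ 1)
    {ε : ℝ} (hε : 0 < ε) :
    ∀ᶠ s in 𝓝 s₀, ∃ φ : I ≃o I, (∀ u, dist (φ u) u < ε) ∧ ∀ l, φ (s₀ l) = s l := by
  have := Fintype.ofFinite ι
  -- `r` separates the points from one another and from both ends of the interval.
  obtain ⟨r, hr, hrs⟩ : ∃ r : ℝ, 0 < r ∧ ∀ l, r ≤ s₀ l ∧ r ≤ 1 - s₀ l ∧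
      ∀ k, k ≠ l → r ≤ |(s₀ k : ℝ) - s₀ l| := by
    have hev : ∀ᶠ r : ℝ in 𝓝[>] 0, ∀ l, r ≤ s₀ l ∧ r ≤ 1 - s₀ l ∧
        ∀ k, k ≠ l → r ≤ |(s₀ k : ℝ) - s₀ l| := by
      have hpos : ∀ c : ℝ, 0 < c → ∀ᶠ r : ℝ in 𝓝[>] 0, r ≤ c := fun c hc =>
        nhdsWithin_le_nhds (Iic_mem_nhds hc)
      refine eventually_all.2 fun l => (hpos _ ?_).and ((hpos _ ?_).and
        (eventually_all.2 fun k => eventually_imp_distrib_left.2 fun hk => hpos _ ?_))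
      · exact unitInterval.pos_iff_ne_zero.2 (h0 l)
      · exact sub_pos.2 (unitInterval.lt_one_iff_ne_one.2 (h1 l))
      · exact abs_pos.2 (sub_ne_zero.2 fun h => hk (hinj (Subtype.ext h)))
    obtain ⟨r, hr⟩ := (hev.and self_mem_nhdsWithin).exists
    exact ⟨r, hr.2, hr.1⟩
  -- The tent at `s₀ l` has height `1` and slope at most `1 / r`, and vanishes at `0`, at `1` and at
  -- every other marked point.
  let tent : ι → ℝ → ℝ := fun l x => max 0 (1 - |x - (s₀ l : ℝ)| / r)
  have htent_nonneg : ∀ l x, 0 ≤ tent l x := fun l x => le_max_left _ _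
  have htent_le : ∀ l x, tent l x ≤ 1 := fun l x =>
    max_le zero_le_one (sub_le_self _ (by positivity))
  have htent_zero : ∀ l (x : ℝ), r ≤ |x - (s₀ l : ℝ)| → tent l x = 0 := fun l x h => by
    refine max_eq_left ?_
    rw [sub_nonpos, le_div_iff₀ hr]
    linarith
  have htent_self : ∀ l, tent l (s₀ l) = 1 := fun l => by simp [tent]
  have htent_lip : ∀ l x y, |tent l x - tent l y| ≤ |x - y| / r := fun l x y => by
    refine (abs_max_sub_max_le_max _ _ _ _).trans ?_
    have h2 : (1 - |x - (s₀ l : ℝ)| / r) - (1 - |y - (s₀ l : ℝ)| / r) =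
        (|y - (s₀ l : ℝ)| - |x - (s₀ l : ℝ)|) / r := by
      ring
    rw [h2, abs_div, abs_of_pos hr]
    refine max_le (by simp; positivity) ?_
    refine div_le_div_of_nonneg_right ?_ hr.le
    refine (abs_abs_sub_abs_le_abs_sub _ _).trans ?_
    rw [abs_sub_comm]
    simp
  have hcont : Continuous fun s : ι → I => ∑ l, |(s l : ℝ) - s₀ l| := by fun_prop
  have hlim : Tendsto (fun s : ι → I => ∑ l, |(s l : ℝ) - s₀ l|) (𝓝 s₀) (𝓝 0) := by
    simpa using hcont.tendsto s₀
  -- Total displacement below `ε` keeps `ψ` close to the identity; below `r` it makes the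
  -- perturbation a strict contraction, so `ψ` stays increasing.
  filter_upwards [hlim.eventually (gt_mem_nhds (lt_min hε hr))] with s hs
  rw [lt_min_iff] at hs
  let ψ : ℝ → ℝ := fun x => x + ∑ l, ((s l : ℝ) - s₀ l) * tent l x
  have hψ_mono : StrictMono ψ := fun x y hxy => by
    have hb : |∑ l, ((s l : ℝ) - s₀ l) * tent l x - ∑ l, ((s l : ℝ) - s₀ l) * tent l y| ≤
        (∑ l, |(s l : ℝ) - s₀ l|) * ((y - x) / r) := by
      rw [← Finset.sum_sub_distrib, Finset.sum_mul]
      refine (Finset.abs_sum_le_sum_abs _ _).trans (Finset.sum_le_sum fun l _ => ?_)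
      rw [← mul_sub, abs_mul]
      gcongr
      refine (htent_lip l x y).trans_eq ?_
      rw [abs_sub_comm, abs_of_pos (sub_pos.2 hxy)]
    have hb2 : (∑ l, |(s l : ℝ) - s₀ l|) * ((y - x) / r) < y - x := by
      calc _ < r * ((y - x) / r) := by
            have := div_pos (sub_pos.2 hxy) hr
            gcongr
            exact hs.2
        _ = y - x := by field_simp
    have := (abs_le.1 hb).2
    simp only [ψ]
    linarith
  have hψ0 : ψ 0 = 0 := by
    simp only [ψ, zero_add]
    refine Finset.sum_eq_zero fun l _ => ?_
    rw [htent_zero l 0 (by rw [zero_sub, abs_neg, abs_of_nonneg (s₀ l).2.1]; exact (hrs l).1),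
      mul_zero]
  have hψ1 : ψ 1 = 1 := by
    simp only [ψ, add_eq_left]
    refine Finset.sum_eq_zero fun l _ => ?_
    rw [htent_zero l 1 (by rw [abs_of_nonneg (sub_nonneg.2 (s₀ l).2.2)]; exact (hrs l).2.1),
      mul_zero]
  have hψs : ∀ l, ψ (s₀ l) = s l := fun l => by
    simp only [ψ]
    rw [Finset.sum_eq_single l, htent_self]
    · ring
    · intro k _ hk
      rw [htent_zero k _ ((hrs k).2.2 l hk.symm), mul_zero]
    · simp
  have hψ_dist : ∀ x, |ψ x - x| < ε := fun x => by
    refine lt_of_le_of_lt ?_ hs.1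
    simp only [ψ, add_sub_cancel_left]
    refine (Finset.abs_sum_le_sum_abs _ _).trans (Finset.sum_le_sum fun l _ => ?_)
    rw [abs_mul, abs_of_nonneg (htent_nonneg l x)]
    exact mul_le_of_le_one_right (abs_nonneg _) (htent_le l x)
  have hψ_cont : Continuous ψ := by
    simp only [ψ, tent]
    fun_prop
  have hmaps : ∀ x : I, ψ x ∈ I := fun x =>
    ⟨hψ0 ▸ hψ_mono.monotone x.2.1, hψ1 ▸ hψ_mono.monotone x.2.2⟩
  let θ : I → I := fun x => ⟨ψ x, hmaps x⟩
  have hθ_mono : StrictMono θ := fun x y hxy => hψ_mono hxy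
  have hθ_surj : Function.Surjective θ := fun y => by
    have := intermediate_value_Icc zero_le_one hψ_cont.continuousOn
    rw [hψ0, hψ1] at this
    obtain ⟨x, hx, hxy⟩ := this y.2
    exact ⟨⟨x, hx⟩, Subtype.ext hxy⟩
  refine ⟨hθ_mono.orderIsoOfSurjective θ hθ_surj, fun u => ?_, fun l => Subtype.ext (hψs l)⟩
  rw [Subtype.dist_eq, Real.dist_eq]
  exact hψ_dist u

end TimeChange

/-! ### Step paths and their dependence on the jump times -/

section StepPath

variable {S : Type*}

/-- The number of points of a finite configuration that are at most `t`. -/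
noncomputable def countLE {k : ℕ} (s : Fin k → I) (t : I) : ℕ := (Finset.univ.filter fun l => s l ≤ t).card

theorem countLE_lt {k : ℕ} (s : Fin k → I) (t : I) : countLE s t < k + 1 :=
  Nat.lt_succ_of_le ((Finset.card_filter_le _ _).trans (by simp))

theorem eventually_countLE_eq {k : ℕ} (s : Fin k → I) (t : I) :
    ∀ᶠ u in 𝓝[≥] t, countLE s u = countLE s t := by
  have h : ∀ᶠ u in 𝓝[≥] t, ∀ l, s l ≤ u ↔ s l ≤ t := by
    refine eventually_all.2 fun l => ?_
    rcases le_or_gt (s l) t with hl | hl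
    · filter_upwards [self_mem_nhdsWithin] with u hu
      exact ⟨fun _ => hl, fun _ => hl.trans hu⟩
    · filter_upwards [nhdsWithin_le_nhds (gt_mem_nhds hl)] with u hu
      exact ⟨fun h => absurd h (not_le.2 hu), fun h => absurd h (not_le.2 hl)⟩
  filter_upwards [h] with u hu
  simp only [countLE, hu]

theorem exists_eventually_countLE_eq {k : ℕ} (s : Fin k → I) (t : I) :
    ∃ j, ∀ᶠ u in 𝓝[<] t, countLE s u = j := by
  have h : ∀ᶠ u in 𝓝[<] t, ∀ l, s l ≤ u ↔ s l < t := by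
    refine eventually_all.2 fun l => ?_
    rcases lt_or_ge (s l) t with hl | hl
    · filter_upwards [nhdsWithin_le_nhds (lt_mem_nhds hl)] with u hu
      exact ⟨fun _ => hl, fun _ => le_of_lt hu⟩
    · filter_upwards [self_mem_nhdsWithin] with u hu
      exact ⟨fun h => absurd (h.trans_lt hu) (not_lt.2 hl), fun h => absurd h (not_lt.2 hl)⟩
  refine ⟨(Finset.univ.filter fun l => s l < t).card, ?_⟩
  filter_upwards [h] with u hu
  simp only [countLE, hu]

/-- The path that starts at `a 0` and, at each of the times `s l`, moves on to the next
value of `a`. -/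
noncomputable def stepPath [TopologicalSpace S] {k : ℕ} (a : Fin (k + 1) → S) (s : Fin k → I) :
    SkorokhodSpace S where
  path t := a ⟨countLE s t, countLE_lt s t⟩
  right_continuous t := by
    refine tendsto_const_nhds.congr' ?_
    filter_upwards [eventually_countLE_eq s t] with u hu
    simp only [hu]
  left_limit t := by
    obtain ⟨j, hj⟩ := exists_eventually_countLE_eq s t
    rcases lt_or_ge j (k + 1) with h | h
    · refine ⟨a ⟨j, h⟩, tendsto_const_nhds.congr' ?_⟩
      filter_upwards [hj] with u hu
      simp only [hu]
    -- Such a `j` can occur only if the left neighbourhood filter is trivial, that is at `t = 0`,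
    -- where any value is a left limit.
    · refine ⟨a 0, tendsto_const_nhds.congr' ?_⟩
      filter_upwards [hj] with u hu
      exact absurd (hu ▸ countLE_lt s u) (not_lt.2 h)

theorem stepPath_apply [TopologicalSpace S] {k : ℕ} (a : Fin (k + 1) → S) (s : Fin k → I) (t : I) :
    stepPath a s t = a ⟨countLE s t, countLE_lt s t⟩ := rfl

/-- The configurations of pairwise distinct points in the open unit interval. -/
def properConfig (k : ℕ) : Set (Fin k → I) :=
  {s | (∀ i j, i ≠ j → s i ≠ s j) ∧ ∀ l, s l ≠ 0 ∧ s l ≠ 1}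

theorem isOpen_properConfig (k : ℕ) : IsOpen (properConfig k) := by
  simp only [properConfig, Set.ofPred_and, Set.ofPred_forall]
  refine IsOpen.inter (isOpen_iInter_of_finite fun i => isOpen_iInter_of_finite fun j =>
    isOpen_iInter_of_finite fun _ => isOpen_ne_fun (continuous_apply _) (continuous_apply _)) ?_
  exact isOpen_iInter_of_finite fun l =>
    (isOpen_ne_fun (continuous_apply _) continuous_const).inter
      (isOpen_ne_fun (continuous_apply _) continuous_const)

/-- A time change carrying the jump times `s₀` to `s` matches the two step paths exactly, so their
distance is at most its displacement. -/
theorem continuousOn_stepPath [PseudoEMetricSpace S] {k : ℕ} (a : Fin (k + 1) → S) :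
    ContinuousOn (stepPath a) (properConfig k) := by
  intro s₀ hs₀
  refine ContinuousAt.continuousWithinAt ?_
  rw [ContinuousAt, EMetric.tendsto_nhds]
  intro ε hε
  obtain ⟨ε', hε', hlt⟩ := ENNReal.lt_iff_exists_real_btwn.1 hε
  have hpos : 0 < ε' := by simpa using hlt.1
  filter_upwards [eventually_exists_orderIso (fun i j h => not_imp_not.1 (hs₀.1 i j) h)
    (fun l => (hs₀.2 l).1) (fun l => (hs₀.2 l).2) hpos] with s hs
  obtain ⟨φ, h1, h2⟩ := hs
  rw [edist_comm, SkorokhodSpace.edist_def]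
  refine ((iInf_le _ φ).trans (max_le (iSup_le fun u => ?_) (iSup_le fun u => ?_))).trans_lt hlt.2
  · rw [edist_dist]
    exact ENNReal.ofReal_le_ofReal (h1 u).le
  · have : countLE s (φ u) = countLE s₀ u := by
      simp only [countLE, ← h2, φ.le_iff_le]
    simp [stepPath_apply, this]

theorem volume_properConfig_compl (k : ℕ) : volume (properConfig k)ᶜ = 0 := by
  have hsub : (properConfig k)ᶜ ⊆ (⋃ i, ⋃ j, ⋃ _ : i ≠ j, {s | s i = s j}) ∪
      ⋃ l, ({s : Fin k → I | s l = 0} ∪ {s | s l = 1}) := by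
    intro s hs
    by_contra h
    refine hs ⟨fun i j hij he => h (.inl ?_), fun l => ⟨fun he => h (.inr ?_),
      fun he => h (.inr ?_)⟩⟩
    · exact Set.mem_iUnion.2 ⟨i, Set.mem_iUnion.2 ⟨j, Set.mem_iUnion.2 ⟨hij, he⟩⟩⟩
    · exact Set.mem_iUnion.2 ⟨l, .inl he⟩
    · exact Set.mem_iUnion.2 ⟨l, .inr he⟩
  have hpt : ∀ (l : Fin k) (c : I), volume {s : Fin k → I | s l = c} = 0 := fun l c =>
    (Measure.quasiMeasurePreserving_eval (fun _ : Fin k => (volume : Measure I)) l).preimage_null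
      (measure_singleton c)
  refine measure_mono_null hsub (measure_union_null ?_ ?_)
  · simp only [measure_iUnion_null_iff]
    intro i j hij
    -- Two distinct coordinates are independent, so their joint law is the product measure, for
    -- which the diagonal is null by Fubini.
    have hind := (ProbabilityTheory.iIndepFun_pi (Ω := fun _ : Fin k => I)
      (μ := fun _ => (volume : Measure I)) (X := fun _ => id) fun _ => aemeasurable_id).indepFun hij
    simp only [id] at hind
    rw [ProbabilityTheory.indepFun_iff_map_prod_eq_prod_map_map
      (measurable_pi_apply i).aemeasurable (measurable_pi_apply j).aemeasurable] at hind
    have he : ∀ l : Fin k, Measure.map (fun s : Fin k → I => s l)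
        (Measure.pi fun _ => (volume : Measure I)) = volume := fun l =>
      (measurePreserving_eval (fun _ : Fin k => (volume : Measure I)) l).map_eq
    rw [he, he] at hind
    have hd : MeasurableSet {p : I × I | p.1 = p.2} :=
      measurableSet_eq_fun measurable_fst measurable_snd
    have h0 : (volume : Measure I).prod volume {p : I × I | p.1 = p.2} = 0 := by
      rw [Measure.measure_prod_null hd]
      refine .of_forall fun x => ?_
      refine measure_mono_null (t := {x}) (fun y hy => ?_) (measure_singleton x)
      exact (show x = y from hy).symm
    rw [← hind, Measure.map_apply (by fun_prop) hd] at h0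
    exact h0
  · simp only [measure_iUnion_null_iff]
    exact fun l => measure_union_null (hpt l 0) (hpt l 1)

end StepPath

/-! ### Laws of step paths and the bins of their jump times -/

section Law

variable {S : Type*} [PseudoEMetricSpace S]

theorem aemeasurable_stepPath {k : ℕ} (a : Fin (k + 1) → S) :
    AEMeasurable (stepPath a) volume := by
  have h : volume.restrict (properConfig k) = (volume : Measure (Fin k → I)) :=
    Measure.restrict_eq_self_of_ae_mem (volume_properConfig_compl k)
  rw [← h]
  exact (continuousOn_stepPath a).aemeasurable (isOpen_properConfig k).measurableSet

/-- The law of the step path through `a` whose jump times are the order statistics of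
independent uniform random variables. -/
noncomputable def stepLaw {k : ℕ} (a : Fin (k + 1) → S) : Measure (SkorokhodSpace S) :=
  Measure.map (stepPath a) volume

instance {k : ℕ} (a : Fin (k + 1) → S) : IsProbabilityMeasure (stepLaw a) :=
  Measure.isProbabilityMeasure_map (aemeasurable_stepPath a)

theorem stepLaw_apply {k : ℕ} (a : Fin (k + 1) → S) {B : Set (SkorokhodSpace S)}
    (hB : MeasurableSet B) : stepLaw a B = volume (stepPath a ⁻¹' B) :=
  Measure.map_apply_of_aemeasurable (aemeasurable_stepPath a) hB

/-- Compact sets of proper configurations have compact images under the step path, and they exhaust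
the mass of any preimage. -/
instance {k : ℕ} (a : Fin (k + 1) → S) : (stepLaw a).InnerRegular := by
  refine ⟨fun B hB r hr => ?_⟩
  have h1 : NullMeasurableSet (stepPath a ⁻¹' B) volume :=
    (aemeasurable_stepPath a).nullMeasurableSet_preimage hB
  have hO : NullMeasurableSet (properConfig k) volume :=
    (isOpen_properConfig k).measurableSet.nullMeasurableSet
  rw [stepLaw_apply a hB, ← measure_inter_conull (volume_properConfig_compl k)] at hr
  -- The preimage is only null measurable; it is replaced by a measurable subset of the same
  -- measure.
  obtain ⟨M, hM, hMm, hMe⟩ := (h1.inter hO).exists_measurable_subset_ae_eq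
  rw [← measure_congr hMe] at hr
  obtain ⟨K, hKM, hK, hlt⟩ := hMm.exists_lt_isCompact hr
  have hsub := hKM.trans hM
  have hcomp : IsCompact (stepPath a '' K) :=
    hK.image_of_continuousOn ((continuousOn_stepPath a).mono fun x hx => (hsub hx).2)
  refine ⟨stepPath a '' K, Set.image_subset_iff.2 fun x hx => (hsub hx).1, hcomp, ?_⟩
  refine hlt.trans_le ((measure_mono (Set.subset_preimage_image (stepPath a) K)).trans ?_)
  exact Measure.le_map_apply (aemeasurable_stepPath a) _

/-- The index of the interval cut out by `t` that contains `u`. -/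
noncomputable def bin {n : ℕ} (t : Fin n → I) (u : I) : Fin (n + 1) :=
  ⟨(Finset.univ.filter fun i => t i < u).card,
    Nat.lt_succ_of_le ((Finset.card_filter_le _ _).trans (by simp))⟩

/-- The indices `i` with `t i < u` form an initial segment, determined by its cardinality. -/
theorem lt_iff_lt_bin {n : ℕ} {t : Fin n → I} (ht : StrictMono t) (u : I) (i : Fin n) :
    t i < u ↔ (i : ℕ) < bin t u := by
  constructor
  · intro h
    have : Finset.Iic i ⊆ Finset.univ.filter fun i => t i < u := fun j hj => by
      simpa using (ht.monotone (Finset.mem_Iic.1 hj)).trans_lt h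
    have := Finset.card_le_card this
    rw [Fin.card_Iic] at this
    exact this
  · intro h
    by_contra hi
    have : (Finset.univ.filter fun i => t i < u) ⊆ Finset.Iio i := fun j hj => by
      rw [Finset.mem_Iio]
      by_contra hij
      exact hi ((ht.monotone (not_lt.1 hij)).trans_lt (Finset.mem_filter.1 hj).2)
    have := Finset.card_le_card this
    rw [Fin.card_Iio] at this
    exact absurd h (not_lt.2 this)

theorem le_iff_bin_le {n : ℕ} {t : Fin n → I} (ht : StrictMono t) (u : I) (i : Fin n) :
    u ≤ t i ↔ (bin t u : ℕ) ≤ i := by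
  rw [← not_lt, lt_iff_lt_bin ht, not_lt]

/-- The lengths of the successive intervals cut out by `0, t 0, …, t (n - 1), 1`. -/
noncomputable def gap {n : ℕ} (t : Fin n → ℝ) (b : Fin (n + 1)) : ℝ :=
  (Fin.snoc t 1 : Fin (n + 1) → ℝ) b - (Fin.cons 0 t : Fin (n + 1) → ℝ) b

theorem bin_eq_iff {n : ℕ} {t : Fin n → I} (ht : StrictMono t) (u : I) (b : Fin (n + 1)) :
    bin t u = b ↔ (∀ i : Fin n, (i : ℕ) < b → t i < u) ∧ ∀ i : Fin n, (b : ℕ) ≤ i → u ≤ t i := by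
  simp only [lt_iff_lt_bin ht, le_iff_bin_le ht, Fin.ext_iff]
  constructor
  · intro h
    constructor <;> intro i hi <;> omega
  · rintro ⟨h1, h2⟩
    by_contra hne
    rcases lt_or_gt_of_ne hne with h | h
    · have := h1 ⟨bin t u, by omega⟩ h
      simp at this
    · have := h2 ⟨b, by omega⟩ le_rfl
      simp at this
      omega

/-- A bin lies between a half-open interval and its closure (the first bin also contains `0`), and
points have measure zero. -/
theorem volume_real_bin_eq {n : ℕ} {t : Fin n → I} (ht : StrictMono t) (b : Fin (n + 1)) :
    volume.real {u | bin t u = b} = gap (fun i => (t i : ℝ)) b := by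
  let lo : I := (Fin.cons 0 t : Fin (n + 1) → I) b
  let hi : I := (Fin.snoc t 1 : Fin (n + 1) → I) b
  have h1 : Set.Ioc lo hi ⊆ {u | bin t u = b} := fun u hu => by
    rw [Set.mem_ofPred_eq, bin_eq_iff ht]
    refine ⟨fun i hib => lt_of_le_of_lt ?_ hu.1, fun i hib => hu.2.trans ?_⟩
    · obtain ⟨j, rfl⟩ := Fin.exists_succ_eq.2 (show b ≠ 0 by rintro rfl; simp at hib)
      simp only [lo, Fin.cons_succ]
      exact ht.monotone (Fin.le_def.2 (by simpa [Nat.lt_succ_iff] using hib))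
    · obtain ⟨j, rfl⟩ := Fin.exists_castSucc_eq.2 (show b ≠ Fin.last n by
        rintro rfl; simp at hib; omega)
      simp only [hi, Fin.snoc_castSucc]
      exact ht.monotone (Fin.le_def.2 (by simpa using hib))
  have h2 : {u | bin t u = b} ⊆ Set.Icc lo hi := fun u hu => by
    rw [Set.mem_ofPred_eq, bin_eq_iff ht] at hu
    constructor
    · rcases Fin.eq_zero_or_eq_succ b with rfl | ⟨j, rfl⟩
      · exact u.2.1
      · simp only [lo, Fin.cons_succ]
        exact (hu.1 j (by simp)).le
    · rcases Fin.eq_castSucc_or_eq_last b with ⟨j, rfl⟩ | rfl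
      · simp only [hi, Fin.snoc_castSucc]
        exact hu.2 j (by simp)
      · simp only [hi, Fin.snoc_last]
        exact u.2.2
  have h3 : volume (Set.Icc lo hi) ≤ volume (Set.Ioc lo hi) := by simp
  have hle : lo ≤ hi := by
    rcases Fin.eq_zero_or_eq_succ b with rfl | ⟨j, rfl⟩
    · exact (hi).2.1
    · rcases Fin.eq_castSucc_or_eq_last j.succ with ⟨i, hi'⟩ | hl
      · simp only [lo, hi, Fin.cons_succ]
        rw [hi', Fin.snoc_castSucc]
        refine ht.monotone (Fin.le_def.2 ?_)
        have := congrArg Fin.val hi'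
        simp at this
        omega
      · simp only [hi, hl, Fin.snoc_last]
        exact (lo).2.2
  have h4 : volume {u | bin t u = b} = volume (Set.Ioc lo hi) :=
    le_antisymm ((measure_mono h2).trans h3) (measure_mono h1)
  have hlo : (lo : ℝ) = (Fin.cons 0 fun i => (t i : ℝ) : Fin (n + 1) → ℝ) b := by
    rcases Fin.eq_zero_or_eq_succ b with rfl | ⟨j, rfl⟩ <;> simp [lo]
  have hhi : (hi : ℝ) = (Fin.snoc (fun i => (t i : ℝ)) 1 : Fin (n + 1) → ℝ) b := by
    rcases Fin.eq_castSucc_or_eq_last b with ⟨j, rfl⟩ | rfl <;> simp [hi]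
  rw [Measure.real, h4, gap, ← hlo, ← hhi]
  rw [unitInterval.volume_Ioc, ENNReal.toReal_ofReal (sub_nonneg.2 hle)]

theorem countLE_eq_card_bin {n k : ℕ} {t : Fin n → I} (ht : StrictMono t) (s : Fin k → I)
    (i : Fin n) :
    countLE s (t i) = (Finset.univ.filter fun l => (bin t (s l) : ℕ) ≤ i).card := by
  simp only [countLE, le_iff_bin_le ht]

theorem measurable_bin {n : ℕ} (t : Fin n → I) : Measurable (bin t) := by
  have h : Measurable fun u => (bin t u : ℕ) := by
    simp only [bin, Finset.card_filter]
    exact Finset.measurable_sum _ fun i _ =>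
      Measurable.ite (measurableSet_Ioi (a := t i)) measurable_const measurable_const
  refine measurable_to_countable' fun b => ?_
  have : bin t ⁻¹' {b} = (fun u => (bin t u : ℕ)) ⁻¹' {(b : ℕ)} := by
    ext u
    simp [Fin.ext_iff]
  rw [this]
  exact h (measurableSet_singleton _)

/-- The bins of independent uniform points are independent, with the gap lengths as probabilities.
-/
theorem volume_real_setOf_bin {n k : ℕ} {t : Fin n → I} (ht : StrictMono t)
    (Q : (Fin k → Fin (n + 1)) → Prop) [DecidablePred Q] :
    volume.real {s : Fin k → I | Q fun l => bin t (s l)} =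
      ∑ c : Fin k → Fin (n + 1), if Q c then ∏ l, gap (fun i => (t i : ℝ)) (c l) else 0 := by
  have hm : Measurable fun s : Fin k → I => fun l => bin t (s l) :=
    measurable_pi_lambda _ fun l => (measurable_bin t).comp (measurable_pi_apply l)
  have hset : {s : Fin k → I | Q fun l => bin t (s l)} =
      ⋃ c ∈ Finset.univ.filter Q, (fun (s : Fin k → I) l => bin t (s l)) ⁻¹' {c} := by
    ext s
    simp
  rw [hset, measureReal_biUnion_finset (fun c _ c' _ hne => Disjoint.preimage _ (by simpa using hne))
    (fun c _ => hm (measurableSet_singleton c)), Finset.sum_filter]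
  refine Finset.sum_congr rfl fun c _ => ?_
  congr 1
  have hpi : (fun (s : Fin k → I) l => bin t (s l)) ⁻¹' {c} =
      Set.univ.pi fun l => {u | bin t u = c l} := by
    ext s
    simp [funext_iff]
  rw [hpi, Measure.real, volume_pi, Measure.pi_pi, ENNReal.toReal_prod]
  exact Finset.prod_congr rfl fun l _ => volume_real_bin_eq ht (c l)

end Law

/-! ### Algebra of words in the projections and `K` -/

section Words

variable {R S : Type*} [Ring R]

/-- The alternating product `P (a k) * K * P (a (k - 1)) * ⋯ * K * P (a 0)`. -/
def word (P : S → R) (K : R) : (k : ℕ) → (Fin (k + 1) → S) → R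
  | 0, a => P (a 0)
  | k + 1, a => P (a (Fin.last _)) * K * word P K k (Fin.init a)

variable [Fintype S]

open scoped Classical in
/-- The sum of the projections `P a` over `a ∈ A`. -/
noncomputable def projSum (P : S → R) (A : Set S) : R := ∑ a, if a ∈ A then P a else 0

/-- The alternating product `P_{G k} * K * P_{G (k - 1)} * ⋯ * K * P_{G 0}`. -/
noncomputable def setWord (P : S → R) (K : R) (G : ℕ → Set S) : ℕ → R
  | 0 => projSum P (G 0)
  | k + 1 => projSum P (G (k + 1)) * K * setWord P K G k

variable (P : S → R) (K : R)

open scoped Classical in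
theorem sum_word_eq_setWord (G : ℕ → Set S) (k : ℕ) :
    (∑ a : Fin (k + 1) → S, if ∀ l : Fin (k + 1), a l ∈ G l then word P K k a else 0) =
      setWord P K G k := by
  induction k with
  | zero =>
    rw [setWord, projSum, ← (Equiv.funUnique (Fin 1) S).sum_comp]
    refine Finset.sum_congr rfl fun a _ => ?_
    simp [word]
  | succ k ih =>
    rw [setWord, ← ih, projSum, ← (Fin.snocEquiv fun _ : Fin (k + 2) => S).sum_comp,
      Fintype.sum_prod_type, Finset.sum_mul, Finset.sum_mul]
    refine Finset.sum_congr rfl fun a _ => ?_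
    rw [Finset.mul_sum]
    refine Finset.sum_congr rfl fun b _ => ?_
    by_cases h1 : a ∈ G (k + 1) <;> by_cases h2 : ∀ l : Fin (k + 1), b l ∈ G l <;>
      simp [Fin.forall_fin_succ', Fin.snocEquiv, word, h1, h2]

theorem setWord_congr {G G' : ℕ → Set S} {k : ℕ} (h : ∀ l ≤ k, G l = G' l) :
    setWord P K G k = setWord P K G' k := by
  induction k with
  | zero => rw [setWord, setWord, h 0 le_rfl]
  | succ k ih => rw [setWord, setWord, h _ le_rfl, ih fun l hl => h l (hl.trans k.le_succ)]

theorem projSum_univ (hP : ∑ a, P a = 1) : projSum P Set.univ = 1 := by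
  simp [projSum, hP]

theorem projSum_inter (hP : ∀ a, P a * P a = P a) (hP' : ∀ a b, a ≠ b → P a * P b = 0)
    (A B : Set S) : projSum P (A ∩ B) = projSum P A * projSum P B := by
  rw [projSum, projSum, projSum, Finset.sum_mul_sum]
  refine Finset.sum_congr rfl fun a _ => ?_
  rw [Finset.sum_eq_single a]
  · by_cases h1 : a ∈ A <;> by_cases h2 : a ∈ B <;> simp [h1, h2, hP]
  · intro b _ hb
    by_cases h1 : a ∈ A <;> by_cases h2 : b ∈ B <;> simp [h1, h2, hP' _ _ hb.symm]
  · simp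

/-- Each unconstrained letter sums to `1` and leaves a bare factor `K`. -/
theorem setWord_eq_pow_mul (hP : ∑ a, P a = 1) {G : ℕ → Set S} {j k : ℕ} (hjk : j ≤ k)
    (hG : ∀ l, j < l → G l = Set.univ) : setWord P K G k = K ^ (k - j) * setWord P K G j := by
  induction k, hjk using Nat.le_induction with
  | base => simp
  | succ k hk ih =>
    rw [setWord, ih, hG _ (Nat.lt_succ_of_le hk), projSum_univ P hP, Nat.succ_sub hk, pow_succ',
      one_mul, mul_assoc]

theorem setWord_eq_proj_mul (hP : ∀ a, P a * P a = P a) (hP' : ∀ a b, a ≠ b → P a * P b = 0)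
    {G G' : ℕ → Set S} {A : Set S} {j : ℕ} (hj : G j = A ∩ G' j) (h : ∀ l < j, G l = G' l) :
    setWord P K G j = projSum P A * setWord P K G' j := by
  cases j with
  | zero => rw [setWord, setWord, hj, projSum_inter P hP hP']
  | succ j =>
    rw [setWord, setWord, hj, projSum_inter P hP hP',
      setWord_congr P K fun l hl => h l (Nat.lt_succ_of_le hl)]
    simp only [mul_assoc]

/-- The product `K ^ (k - J (n - 1)) * B (n - 1) * ⋯ * K ^ (J 1 - J 0) * B 0 * K ^ J 0`. -/
def interlaced (K : R) (B : ℕ → R) (J : ℕ → ℕ) : ℕ → ℕ → R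
  | 0, k => K ^ k
  | n + 1, k => K ^ (k - J n) * B n * interlaced K B J n (J n)

/-- The letter `l` carries the constraints of all `i` with `J i = l`. Coinciding `J i` intersect
their sets, which agrees with the projections multiplying across `K ^ 0`. The induction peels off
the last constraint, beyond which all letters are free. -/
theorem setWord_eq_interlaced (h1 : ∑ a, P a = 1)
    (hP : ∀ a, P a * P a = P a) (hP' : ∀ a b, a ≠ b → P a * P b = 0) (A : ℕ → Set S)
    {J : ℕ → ℕ} (hJ : Monotone J) (n : ℕ) {k : ℕ} (hk : ∀ i < n, J i ≤ k) :
    setWord P K (fun l => {s | ∀ i < n, J i = l → s ∈ A i}) k =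
      interlaced K (fun i => projSum P (A i)) J n k := by
  induction n generalizing k with
  | zero =>
    rw [interlaced, setWord_eq_pow_mul P K h1 (Nat.zero_le k) (by simp)]
    simp [setWord, projSum_univ P h1]
  | succ n ih =>
    rw [interlaced, setWord_eq_pow_mul P K h1 (hk n n.lt_succ_self), mul_assoc,
      setWord_eq_proj_mul P K hP hP' (A := A n)
        (G' := fun l => {s | ∀ i < n, J i = l → s ∈ A i}), ih fun i hi => hJ hi.le]
    · ext s
      simp only [Nat.lt_succ_iff_lt_or_eq, Set.mem_ofPred_eq, Set.mem_inter_iff]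
      grind
    · intro l hl
      ext s
      simp only [Nat.lt_succ_iff_lt_or_eq, Set.mem_ofPred_eq]
      grind
    · intro l hl
      refine Set.eq_univ_of_forall fun s i hi he => ?_
      have := hJ (Nat.lt_succ_iff.1 hi)
      omega

/-- The product `K ^ c n * B (n - 1) * K ^ c (n - 1) * ⋯ * B 0 * K ^ c 0`. -/
def blockProd (K : R) (B : ℕ → R) : (n : ℕ) → (Fin (n + 1) → ℕ) → R
  | 0, c => K ^ c 0
  | n + 1, c => K ^ c (Fin.last _) * B n * blockProd K B n (Fin.init c)

theorem interlaced_eq_blockProd (B : ℕ → R) (n : ℕ) (c : Fin (n + 1) → ℕ) {J : ℕ → ℕ}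
    (hJ : ∀ i < n, J i = ∑ b ∈ Finset.univ.filter (fun b : Fin (n + 1) => (b : ℕ) ≤ i), c b) :
    interlaced K B J n (∑ b, c b) = blockProd K B n c := by
  induction n with
  | zero => simp [interlaced, blockProd]
  | succ n ih =>
    have hn : J n = ∑ b, Fin.init c b := by
      rw [hJ n n.lt_succ_self, Finset.sum_filter, Fin.sum_univ_castSucc]
      simp [Fin.init, Fin.is_le]
    rw [interlaced, blockProd, hn, ih]
    · rw [Fin.sum_univ_castSucc c]
      simp [Fin.init]
    · intro i hi
      rw [hJ i (hi.trans n.lt_succ_self), Finset.sum_filter, Finset.sum_filter,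
        Fin.sum_univ_castSucc]
      simp [Fin.init]
      exact fun h => absurd h (by omega)

end Words

/-! ### Multinomial counting -/

section Counts

/-- The number of times each value is taken. -/
def counts {β : Type*} [DecidableEq β] {k : ℕ} (x : Fin k → β) (b : β) : ℕ :=
  (Finset.univ.filter fun l => x l = b).card

/-- This is the multinomial theorem with `g d` in place of the monomial of exponent `d`: both sides
are images of `(∑ p b X b) ^ k` under the linear map `Λ` that makes this replacement. -/
theorem sum_smul_comp_counts {β M : Type*} [Fintype β] [DecidableEq β] [AddCommGroup M]
    [Module ℝ M] (p : β → ℝ) (g : (β → ℕ) → M) (k : ℕ) :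
    ∑ x : Fin k → β, (∏ l, p (x l)) • g (counts x) =
      ∑ d ∈ Finset.piAntidiag Finset.univ k,
        ((Nat.multinomial Finset.univ d : ℝ) * ∏ b, p b ^ d b) • g d := by
  obtain ⟨Λ, hΛ⟩ : ∃ Λ : MvPolynomial β ℝ →ₗ[ℝ] M,
      ∀ (d : β →₀ ℕ) (r : ℝ), Λ (MvPolynomial.monomial d r) = r • g d := by
    refine ⟨(MvPolynomial.basisMonomials β ℝ).constr ℝ fun d => g d, fun d r => ?_⟩
    have : MvPolynomial.monomial d r = r • MvPolynomial.basisMonomials β ℝ d := by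
      rw [MvPolynomial.coe_basisMonomials, MvPolynomial.smul_monomial, smul_eq_mul, mul_one]
    rw [this, map_smul, Module.Basis.constr_basis]
  have hmon : ∀ (d : β → ℕ) (r : ℝ),
      MvPolynomial.C r * ∏ b, (MvPolynomial.X b : MvPolynomial β ℝ) ^ d b =
        MvPolynomial.monomial (Finsupp.equivFunOnFinite.symm d) r := fun d r => by
    rw [MvPolynomial.monomial_eq, Finsupp.prod_fintype _ _ (by simp)]
    simp
  have hcount : ∀ x : Fin k → β, ∏ l, (MvPolynomial.X (x l) : MvPolynomial β ℝ) =
      ∏ b, (MvPolynomial.X b : MvPolynomial β ℝ) ^ counts x b := fun x => by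
    rw [Finset.prod_comp, Finset.prod_subset (Finset.subset_univ _)]
    · rfl
    · intro b _ hb
      rw [Finset.card_eq_zero.2, pow_zero]
      refine Finset.filter_eq_empty_iff.2 fun l _ hl => hb ?_
      exact Finset.mem_image.2 ⟨l, Finset.mem_univ _, hl⟩
  have h1 : Λ ((∑ b, MvPolynomial.C (p b) * MvPolynomial.X b) ^ k) =
      ∑ x : Fin k → β, (∏ l, p (x l)) • g (counts x) := by
    rw [Fintype.sum_pow, map_sum]
    refine Finset.sum_congr rfl fun x _ => ?_
    rw [Finset.prod_mul_distrib, ← map_prod, hcount, hmon, hΛ, Finsupp.coe_equivFunOnFinite_symm]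
  rw [← h1, Finset.sum_pow_eq_sum_piAntidiag, map_sum]
  refine Finset.sum_congr rfl fun d _ => ?_
  have h2 : (Nat.multinomial Finset.univ d : MvPolynomial β ℝ) *
      ∏ b, (MvPolynomial.C (p b) * MvPolynomial.X b) ^ d b =
      MvPolynomial.C ((Nat.multinomial Finset.univ d : ℝ) * ∏ b, p b ^ d b) *
        ∏ b, (MvPolynomial.X b : MvPolynomial β ℝ) ^ d b := by
    simp only [mul_pow, Finset.prod_mul_distrib, map_mul, map_prod, map_pow, map_natCast]
    ring
  rw [h2, hmon, hΛ, Finsupp.coe_equivFunOnFinite_symm]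

end Counts

/-! ### Absolutely convergent products of exponential series -/

section NormedRing

variable {R : Type*} [NormedRing R] [CompleteSpace R]

theorem hasSum_mul_of_summable_norm {ι κ : Type*} {f : ι → R} {g : κ → R} {a b : R}
    (hf : HasSum f a) (hf' : Summable fun i => ‖f i‖) (hg : HasSum g b)
    (hg' : Summable fun i => ‖g i‖) :
    HasSum (fun x : ι × κ => f x.1 * g x.2) (a * b) := by
  rw [← hf.tsum_eq, ← hg.tsum_eq, tsum_mul_tsum_of_summable_norm hf' hg']
  exact (summable_mul_of_summable_norm hf' hg').hasSum

omit [CompleteSpace R] in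
theorem summable_norm_mul_right {ι : Type*} {f : ι → R} (c : R) (hf : Summable fun i => ‖f i‖) :
    Summable fun i => ‖f i * c‖ :=
  (hf.mul_right ‖c‖).of_nonneg_of_le (fun _ => norm_nonneg _) fun _ => norm_mul_le _ _

end NormedRing

section Series

variable {R : Type*} [NormedRing R] [NormedAlgebra ℝ R] [CompleteSpace R]

/-- The product `exp (p n • K) * B (n - 1) * ⋯ * B 0 * exp (p 0 • K)`. -/
noncomputable def expProd (K : R) (B : ℕ → R) : (n : ℕ) → (Fin (n + 1) → ℝ) → R
  | 0, p => NormedSpace.exp (p 0 • K)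
  | n + 1, p => NormedSpace.exp (p (Fin.last _) • K) * B n * expProd K B n (Fin.init p)

theorem hasSum_pow_div_factorial_smul (K : R) (x : ℝ) :
    HasSum (fun j : ℕ => (x ^ j / (j.factorial : ℝ)) • K ^ j) (NormedSpace.exp (x • K)) ∧
      Summable fun j : ℕ => ‖(x ^ j / (j.factorial : ℝ)) • K ^ j‖ := by
  have h : ∀ j : ℕ, (x ^ j / (j.factorial : ℝ)) • K ^ j =
      ((j.factorial : ℝ)⁻¹) • (x • K) ^ j := fun j => by
    rw [smul_pow, smul_smul, div_eq_inv_mul]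
  simp only [h]
  exact ⟨NormedSpace.exp_series_hasSum_exp' (𝕂 := ℝ) (x • K),
    NormedSpace.norm_expSeries_summable' (𝕂 := ℝ) (x • K)⟩

theorem hasSum_blockProd (K : R) (B : ℕ → R) (n : ℕ) (p : Fin (n + 1) → ℝ) :
    HasSum (fun c : Fin (n + 1) → ℕ =>
      (∏ b, (p b ^ c b / ((c b).factorial : ℝ))) • blockProd K B n c) (expProd K B n p) ∧
    Summable fun c : Fin (n + 1) → ℕ =>
      ‖(∏ b, (p b ^ c b / ((c b).factorial : ℝ))) • blockProd K B n c‖ := by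
  induction n with
  | zero =>
    have h := hasSum_pow_div_factorial_smul K (p 0)
    rw [← (Equiv.funUnique (Fin 1) ℕ).hasSum_iff, ← (Equiv.funUnique (Fin 1) ℕ).summable_iff] at h
    simpa [Function.comp_def, blockProd, expProd] using h
  | succ n ih =>
    obtain ⟨h1, h2⟩ := hasSum_pow_div_factorial_smul K (p (Fin.last _))
    obtain ⟨h3, h4⟩ := ih (Fin.init p)
    have h5 := summable_norm_mul_right (B n) h2
    have h6 := hasSum_mul_of_summable_norm (h1.mul_right (B n)) h5 h3 h4
    have h7 := h5.mul_norm h4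
    have he : ∀ c : Fin (n + 2) → ℕ,
        (∏ b, (p b ^ c b / ((c b).factorial : ℝ))) • blockProd K B (n + 1) c =
          (p (Fin.last _) ^ c (Fin.last _) / ((c (Fin.last _)).factorial : ℝ)) •
              K ^ c (Fin.last _) * B n *
            ((∏ b, (Fin.init p b ^ Fin.init c b / ((Fin.init c b).factorial : ℝ))) •
              blockProd K B n (Fin.init c)) := fun c => by
      rw [Fin.prod_univ_castSucc, blockProd, smul_mul_assoc, smul_mul_assoc, mul_smul_comm,
        smul_smul, mul_comm]
      rfl
    simp only [he]
    have h8 := (Equiv.hasSum_iff (Fin.snocEquiv fun _ : Fin (n + 2) => ℕ).symm).2 h6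
    have h9 := (Equiv.summable_iff (Fin.snocEquiv fun _ : Fin (n + 2) => ℕ).symm).2 h7
    exact ⟨h8, h9⟩

/-- The product of the exponential series is grouped by total degree `k`. The factor `∏ 1 / (c b)!`
is `1 / k!` times the number of ways to place `k` points in bins with counts `c`. -/
theorem hasSum_sum_blockProd_counts (K : R) (B : ℕ → R) (n : ℕ) (p : Fin (n + 1) → ℝ) :
    HasSum (fun k : ℕ => ((k.factorial : ℝ)⁻¹) • ∑ x : Fin k → Fin (n + 1),
      (∏ l, p (x l)) • blockProd K B n (counts x)) (expProd K B n p) := by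
  refine ((Equiv.hasSum_iff (Equiv.sigmaFiberEquiv fun c : Fin (n + 1) → ℕ => ∑ b, c b)).2
    (hasSum_blockProd K B n p).1).sigma fun k => ?_
  rw [sum_smul_comp_counts p (blockProd K B n), Finset.smul_sum]
  refine (hasSum_subtype_iff_indicator (s := {c : Fin (n + 1) → ℕ | ∑ b, c b = k})
    (f := fun c => (∏ b, (p b ^ c b / ((c b).factorial : ℝ))) • blockProd K B n c)).2 ?_
  have hz : ∀ c ∉ Finset.piAntidiag (Finset.univ : Finset (Fin (n + 1))) k,
      Set.indicator {c : Fin (n + 1) → ℕ | ∑ b, c b = k} (fun c =>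
        (∏ b, (p b ^ c b / ((c b).factorial : ℝ))) • blockProd K B n c) c = 0 := fun c hc =>
    Set.indicator_of_notMem (by simpa using hc) _
  have hs := hasSum_sum_of_ne_finset_zero (L := .unconditional _) hz
  convert hs using 1
  refine Finset.sum_congr rfl fun c hc => ?_
  have hck : ∑ b, c b = k := by simpa using hc
  rw [Set.indicator_of_mem (by exact hck), smul_smul, Finset.prod_div_distrib]
  congr 1
  have hspec : (∏ b, ((c b).factorial : ℝ)) * (Nat.multinomial Finset.univ c : ℝ) =
      (k.factorial : ℝ) := by
    have := Nat.multinomial_spec Finset.univ c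
    rw [hck] at this
    exact_mod_cast this
  have h1 : (∏ b, ((c b).factorial : ℝ)) ≠ 0 :=
    Finset.prod_ne_zero_iff.2 fun b _ => by positivity
  have h2 : (k.factorial : ℝ) ≠ 0 := by positivity
  rw [← hspec] at h2 ⊢
  field_simp [(mul_ne_zero_iff.1 h2).2]

end Series

/-! ### The path measure and its finite-dimensional marginals -/

section DysonMeasure

theorem card_filter_le_eq_sum_counts {n k : ℕ} (x : Fin k → Fin (n + 1)) (i : ℕ) :
    (Finset.univ.filter fun l => (x l : ℕ) ≤ i).card =
      ∑ b ∈ Finset.univ.filter (fun b : Fin (n + 1) => (b : ℕ) ≤ i), counts x b := by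
  rw [Finset.card_eq_sum_card_fiberwise (f := x)
    (t := Finset.univ.filter fun b : Fin (n + 1) => (b : ℕ) ≤ i) (fun l hl => by simpa using hl)]
  refine Finset.sum_congr rfl fun b hb => ?_
  rw [counts, Finset.filter_filter]
  congr 1
  ext l
  simp only [Finset.mem_filter, Finset.mem_univ, true_and] at hb ⊢
  exact ⟨fun h => h.2, fun h => ⟨h ▸ hb, h⟩⟩

theorem sum_counts {n k : ℕ} (x : Fin k → Fin (n + 1)) : ∑ b, counts x b = k := by
  have := Finset.card_eq_sum_card_fiberwise (f := x) (s := Finset.univ) (t := Finset.univ)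
    (fun _ _ => Finset.mem_coe.2 (Finset.mem_univ _))
  simpa [counts] using this.symm

theorem card_filter_le_lt {n k : ℕ} (x : Fin k → Fin (n + 1)) (i : ℕ) :
    (Finset.univ.filter fun l => (x l : ℕ) ≤ i).card < k + 1 :=
  Nat.lt_succ_of_le ((Finset.card_filter_le _ _).trans (by simp))

open scoped Classical in
theorem sum_word_eq_blockProd {R S : Type*} [Ring R] [Fintype S] (P : S → R) (K : R)
    (h1 : ∑ a, P a = 1) (hP : ∀ a, P a * P a = P a) (hP' : ∀ a b, a ≠ b → P a * P b = 0) (A : ℕ → Set S)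
    {n k : ℕ} (x : Fin k → Fin (n + 1)) :
    (∑ a : Fin (k + 1) → S,
      if ∀ i : Fin n, a ⟨(Finset.univ.filter fun l => (x l : ℕ) ≤ i).card,
        card_filter_le_lt x i⟩ ∈ A i then word P K k a else 0) =
      blockProd K (fun i => projSum P (A i)) n (counts x) := by
  let J : ℕ → ℕ := fun i => (Finset.univ.filter fun l => (x l : ℕ) ≤ i).card
  have hJ : Monotone J := fun i j hij => Finset.card_le_card fun l hl => by
    simp only [Finset.mem_filter, Finset.mem_univ, true_and] at hl ⊢
    exact hl.trans hij
  have hJk : ∀ i, J i ≤ k := fun i => Nat.lt_succ_iff.1 (card_filter_le_lt x i)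
  have h2 := sum_word_eq_setWord P K (fun l => {s | ∀ i < n, J i = l → s ∈ A i}) k
  rw [setWord_eq_interlaced P K h1 hP hP' A hJ n fun i _ => hJk i] at h2
  have h3 := interlaced_eq_blockProd K (fun i => projSum P (A i)) n (counts x) (J := J)
    fun i _ => card_filter_le_eq_sum_counts x i
  rw [sum_counts] at h3
  rw [← h3, ← h2]
  refine Finset.sum_congr rfl fun a _ => ?_
  have hiff : (∀ i : Fin n, a ⟨(Finset.univ.filter fun l => (x l : ℕ) ≤ i).card,
      card_filter_le_lt x i⟩ ∈ A i) ↔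
      ∀ l : Fin (k + 1), a l ∈ {s | ∀ i < n, J i = l → s ∈ A i} := by
    constructor
    · intro h l i hi he
      have := h ⟨i, hi⟩
      convert this
      exact he.symm
    · intro h i
      exact h _ i i.2 rfl
  by_cases h : ∀ i : Fin n, a ⟨(Finset.univ.filter fun l => (x l : ℕ) ≤ i).card,
      card_filter_le_lt x i⟩ ∈ A i
  · rw [if_pos h, if_pos (hiff.1 h)]
  · rw [if_neg h, if_neg fun h' => h (hiff.2 h')]

variable {R S : Type*} [NormedRing R] [NormedAlgebra ℝ R]

/-- The weight of a word in the Dyson expansion. -/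
noncomputable def dysonWeight (P : S → R) (K : R) (τ : R →L[ℝ] ℂ)
    (i : Σ k : ℕ, Fin (k + 1) → S) : ℂ :=
  ((i.1.factorial : ℝ)⁻¹ : ℝ) * τ (word P K i.1 i.2)

omit [NormedAlgebra ℝ R] in
theorem norm_word_le (P : S → R) (K : R) {c : ℝ} (hc : 0 ≤ c) (hP : ∀ a, ‖P a‖ ≤ c) (k : ℕ)
    (a : Fin (k + 1) → S) : ‖word P K k a‖ ≤ c * (c * ‖K‖) ^ k := by
  induction k with
  | zero => simpa [word] using hP _
  | succ k ih =>
    rw [word]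
    calc _ ≤ ‖P (a (Fin.last _))‖ * ‖K‖ * ‖word P K k (Fin.init a)‖ :=
          (norm_mul_le _ _).trans (by gcongr; exact norm_mul_le _ _)
      _ ≤ c * ‖K‖ * (c * (c * ‖K‖) ^ k) := by
          gcongr
          · exact hP _
          · exact ih _
      _ = _ := by ring

/-- The number of words and the norm of each grow at most geometrically in `k`, against `1 / k!`. -/
theorem summable_norm_dysonWeight [Fintype S] (P : S → R) (K : R) (τ : R →L[ℝ] ℂ) :
    Summable fun i => ‖dysonWeight P K τ i‖ := by
  obtain ⟨c, hc⟩ := (Set.finite_range fun a => ‖P a‖).bddAbove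
  -- For empty `S` the bound `c` could be negative, hence the maximum.
  have hP : ∀ a, ‖P a‖ ≤ max c 0 := fun a => (hc ⟨a, rfl⟩).trans (le_max_left _ _)
  set d := max c 0
  have hd : 0 ≤ d := le_max_right _ _
  rw [summable_sigma_of_nonneg fun _ => norm_nonneg _]
  refine ⟨fun k => (hasSum_fintype _).summable, ?_⟩
  have hs := (Real.summable_pow_div_factorial (Fintype.card S * (d * ‖K‖))).mul_left
    (Fintype.card S * (‖τ‖ * d))
  refine hs.of_nonneg_of_le (fun k => tsum_nonneg fun _ => norm_nonneg _) fun k => ?_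
  rw [tsum_fintype]
  calc ∑ a : Fin (k + 1) → S, ‖dysonWeight P K τ ⟨k, a⟩‖
      ≤ ∑ _a : Fin (k + 1) → S, (k.factorial : ℝ)⁻¹ * (‖τ‖ * (d * (d * ‖K‖) ^ k)) := by
        refine Finset.sum_le_sum fun a _ => ?_
        rw [dysonWeight, norm_mul, Complex.norm_real, Real.norm_of_nonneg (by positivity)]
        gcongr
        exact (τ.le_opNorm _).trans (by gcongr; exact norm_word_le P K hd hP k a)
    _ = _ := by
        rw [Finset.sum_const, Finset.card_univ, Fintype.card_fun, Fintype.card_fin, nsmul_eq_mul]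
        push_cast
        ring

variable [PseudoEMetricSpace S] [Fintype S]

/-- The complex path measure given by the Dyson expansion of `exp K` along the projections `P a`. -/
noncomputable def dysonMeasure (P : S → R) (K : R) (τ : R →L[ℝ] ℂ) :
    ComplexMeasure (SkorokhodSpace S) :=
  weightedSum (fun i : Σ k : ℕ, Fin (k + 1) → S => stepLaw i.2) (dysonWeight P K τ)
    (summable_norm_dysonWeight P K τ)

theorem isBoundedRadon_dysonMeasure (P : S → R) (K : R) (τ : R →L[ℝ] ℂ) :
    IsBoundedRadon (dysonMeasure P K τ) :=
  isBoundedRadon_weightedSum _ _ _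

omit [Fintype S] in
open scoped Classical in
theorem stepLaw_real_setOf_eval {k n : ℕ} (a : Fin (k + 1) → S) {t : Fin n → I}
    (ht : StrictMono t) (A : ℕ → Set S)
    (hm : MeasurableSet {ξ : SkorokhodSpace S | ∀ i : Fin n, ξ (t i) ∈ A i}) :
    (stepLaw a).real {ξ | ∀ i : Fin n, ξ (t i) ∈ A i} =
      ∑ x : Fin k → Fin (n + 1),
        if ∀ i : Fin n, a ⟨(Finset.univ.filter fun l => (x l : ℕ) ≤ i).card,
          card_filter_le_lt x i⟩ ∈ A i
        then ∏ l, gap (fun i => (t i : ℝ)) (x l) else 0 := by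
  rw [← volume_real_setOf_bin ht fun x : Fin k → Fin (n + 1) => ∀ i : Fin n,
    a ⟨(Finset.univ.filter fun l => (x l : ℕ) ≤ i).card, card_filter_le_lt x i⟩ ∈ A i,
    Measure.real, stepLaw_apply a hm, Measure.real]
  congr 2
  ext s
  simp only [Set.mem_preimage, Set.mem_ofPred_eq, stepPath_apply, countLE_eq_card_bin ht]

theorem dysonMeasure_setOf_eval [CompleteSpace R] (P : S → R) (K : R) (τ : R →L[ℝ] ℂ)
    (h1 : ∑ a, P a = 1) (hP : ∀ a, P a * P a = P a) (hP' : ∀ a b, a ≠ b → P a * P b = 0)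
    {n : ℕ} {t : Fin n → I} (ht : StrictMono t) (A : ℕ → Set S)
    (hm : MeasurableSet {ξ : SkorokhodSpace S | ∀ i : Fin n, ξ (t i) ∈ A i}) :
    dysonMeasure P K τ {ξ | ∀ i : Fin n, ξ (t i) ∈ A i} =
      τ (expProd K (fun i => projSum P (A i)) n (gap fun i => (t i : ℝ))) := by
  classical
  rw [dysonMeasure, weightedSum_apply _ _ _ hm,
    (summable_weighted_measureReal _ (summable_norm_dysonWeight P K τ) _).of_norm.tsum_sigma,
    ← (τ.hasSum (hasSum_sum_blockProd_counts K (fun i => projSum P (A i)) n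
      (gap fun i => (t i : ℝ)))).tsum_eq]
  refine tsum_congr fun k => ?_
  rw [tsum_fintype, map_smul, map_sum, Finset.smul_sum]
  simp only [stepLaw_real_setOf_eval _ ht A hm, dysonWeight, Complex.ofReal_sum, Finset.mul_sum]
  -- With the bins summed outermost, the inner sum over words collapses to a block product.
  rw [Finset.sum_comm]
  refine Finset.sum_congr rfl fun x _ => ?_
  rw [map_smul, ← sum_word_eq_blockProd P K h1 hP hP' A x, map_sum, Finset.smul_sum,
    Finset.smul_sum]
  refine Finset.sum_congr rfl fun a _ => ?_
  split_ifs
  · simp only [Complex.real_smul]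
    ring
  · simp

end DysonMeasure

/-! ### The Lie product formula -/

section LieTrotter

variable {R : Type*} [NormedRing R] [NormedAlgebra ℝ R] [CompleteSpace R]

theorem norm_exp_le [NormOneClass R] (x : R) : ‖NormedSpace.exp x‖ ≤ Real.exp ‖x‖ := by
  have h1 := NormedSpace.exp_series_hasSum_exp' (𝕂 := ℝ) x
  have h2 := NormedSpace.exp_series_hasSum_exp' (𝕂 := ℝ) ‖x‖
  rw [← Real.exp_eq_exp_ℝ] at h2
  refine h1.norm_le_of_bounded h2 fun k => ?_
  rw [norm_smul, smul_eq_mul, norm_inv, RCLike.norm_natCast]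
  gcongr
  exact norm_pow_le _ _

omit [NormedAlgebra ℝ R] [CompleteSpace R] in
theorem norm_pow_sub_pow_le [NormOneClass R] {T U : R} {M : ℝ} (hM : 1 ≤ M) (hT : ‖T‖ ≤ M)
    (hU : ‖U‖ ≤ M) (n : ℕ) : ‖T ^ n - U ^ n‖ ≤ n * ‖T - U‖ * M ^ n := by
  induction n with
  | zero => simp
  | succ n ih =>
    have h : T ^ (n + 1) - U ^ (n + 1) = T ^ n * (T - U) + (T ^ n - U ^ n) * U := by
      rw [pow_succ, pow_succ]; noncomm_ring
    rw [h]
    calc _ ≤ ‖T‖ ^ n * ‖T - U‖ + ‖T ^ n - U ^ n‖ * ‖U‖ :=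
          (norm_add_le _ _).trans (add_le_add ((norm_mul_le _ _).trans
            (by gcongr; exact norm_pow_le _ _)) (norm_mul_le _ _))
      _ ≤ M ^ n * ‖T - U‖ * M + n * ‖T - U‖ * M ^ n * M := by
          refine add_le_add ?_ (by gcongr)
          calc ‖T‖ ^ n * ‖T - U‖ ≤ M ^ n * ‖T - U‖ := by gcongr
            _ ≤ M ^ n * ‖T - U‖ * M := le_mul_of_one_le_right (by positivity) hM
      _ = _ := by push_cast; ring

/-- As functions of the scale `u`, the two sides agree to first order at `0`, so the difference
quotient at `u = 1 / (n + 1)` tends to zero. -/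
theorem tendsto_nat_smul_exp_mul_exp_sub (A B : R) :
    Tendsto (fun n : ℕ => ((n : ℝ) + 1) * ‖NormedSpace.exp (((n : ℝ) + 1)⁻¹ • A) *
      NormedSpace.exp (((n : ℝ) + 1)⁻¹ • B) - NormedSpace.exp (((n : ℝ) + 1)⁻¹ • (A + B))‖)
      atTop (𝓝 0) := by
  have hd : HasDerivAt (fun u : ℝ => NormedSpace.exp (u • A) * NormedSpace.exp (u • B) -
      NormedSpace.exp (u • (A + B))) 0 0 := by
    have h := ((hasDerivAt_exp_smul_const A (0 : ℝ)).mul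
      (hasDerivAt_exp_smul_const B (0 : ℝ))).sub (hasDerivAt_exp_smul_const (A + B) (0 : ℝ))
    simp only [zero_smul, NormedSpace.exp_zero, one_mul, mul_one, sub_self] at h
    exact h
  have h1 : Tendsto (fun n : ℕ => ((n : ℝ) + 1)⁻¹) atTop (𝓝[≠] 0) := by
    refine tendsto_nhdsWithin_iff.2 ⟨?_, .of_forall fun n => ?_⟩
    · exact tendsto_inv_atTop_zero.comp
        (tendsto_atTop_add_const_right atTop (1 : ℝ) tendsto_natCast_atTop_atTop)
    · simp only [Set.mem_compl_iff, Set.mem_singleton_iff, inv_eq_zero]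
      positivity
  have h2 := (hasDerivAt_iff_tendsto_slope_zero.1 hd).comp h1
  have h3 := h2.norm
  rw [norm_zero] at h3
  refine h3.congr fun n => ?_
  simp only [Function.comp_apply, zero_add, zero_smul, NormedSpace.exp_zero, mul_one, sub_self,
    sub_zero, inv_inv, norm_smul]
  rw [Real.norm_of_nonneg (by positivity)]

/-- The Lie product formula. -/
theorem tendsto_exp_mul_exp_pow [NormOneClass R] (A B : R) :
    Tendsto (fun n : ℕ => (NormedSpace.exp (((n : ℝ) + 1)⁻¹ • A) *
      NormedSpace.exp (((n : ℝ) + 1)⁻¹ • B)) ^ (n + 1)) atTop (𝓝 (NormedSpace.exp (A + B))) := by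
  have hU : ∀ n : ℕ, NormedSpace.exp (((n : ℝ) + 1)⁻¹ • (A + B)) ^ (n + 1) =
      NormedSpace.exp (A + B) := fun n => by
    let _ : NormedAlgebra ℚ R := NormedAlgebra.restrictScalars ℚ ℝ R
    rw [← NormedSpace.exp_nsmul, ← Nat.cast_smul_eq_nsmul ℝ, smul_smul]
    have : (n : ℝ) + 1 ≠ 0 := by positivity
    push_cast
    rw [mul_inv_cancel₀ this, one_smul]
  rw [tendsto_iff_norm_sub_tendsto_zero]
  have h := (tendsto_nat_smul_exp_mul_exp_sub A B).mul_const (Real.exp (‖A‖ + ‖B‖))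
  rw [zero_mul] at h
  refine squeeze_zero (fun _ => norm_nonneg _) (fun n => ?_) h
  set c : ℝ := ((n : ℝ) + 1)⁻¹ with hc
  have hc0 : 0 ≤ c := by positivity
  -- This common norm bound has `(n + 1)`-st power `exp (‖A‖ + ‖B‖)`, independent of `n`.
  have hM : (1 : ℝ) ≤ Real.exp (c * (‖A‖ + ‖B‖)) := Real.one_le_exp (by positivity)
  have hT : ‖NormedSpace.exp (c • A) * NormedSpace.exp (c • B)‖ ≤
      Real.exp (c * (‖A‖ + ‖B‖)) := by
    rw [mul_add, Real.exp_add]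
    refine (norm_mul_le _ _).trans ?_
    have h1 := norm_exp_le (c • A)
    have h2 := norm_exp_le (c • B)
    rw [norm_smul, Real.norm_of_nonneg hc0] at h1 h2
    gcongr
  have hU' : ‖NormedSpace.exp (c • (A + B))‖ ≤ Real.exp (c * (‖A‖ + ‖B‖)) := by
    refine (norm_exp_le _).trans (Real.exp_le_exp.2 ?_)
    rw [norm_smul, Real.norm_of_nonneg hc0]
    gcongr
    exact norm_add_le _ _
  have h3 := norm_pow_sub_pow_le hM hT hU' (n + 1)
  rw [hU, ← Real.exp_nat_mul, ← mul_assoc] at h3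
  have h4 : ((n + 1 : ℕ) : ℝ) * c = 1 := by
    rw [hc]; push_cast; exact mul_inv_cancel₀ (by positivity)
  rw [h4, one_mul] at h3
  simpa using h3

theorem exp_sum_smul_of_orthogonal {S : Type*} [Fintype S] (P : S → R) (h1 : ∑ a, P a = 1)
    (hP : ∀ a, P a * P a = P a) (hP' : ∀ a b, a ≠ b → P a * P b = 0) (r : S → ℝ) :
    NormedSpace.exp (∑ a, r a • P a) = ∑ a, Real.exp (r a) • P a := by
  have hpow : ∀ k : ℕ, (∑ a, r a • P a) ^ k = ∑ a, r a ^ k • P a := fun k => by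
    induction k with
    | zero => simp [h1]
    | succ k ih =>
      rw [pow_succ, ih, Finset.sum_mul_sum]
      refine Finset.sum_congr rfl fun a _ => ?_
      rw [Finset.sum_eq_single a]
      · rw [smul_mul_smul_comm, hP, pow_succ]
      · intro b _ hb
        rw [smul_mul_smul_comm, hP' a b hb.symm, smul_zero]
      · simp
  refine (NormedSpace.exp_series_hasSum_exp' (𝕂 := ℝ) (∑ a, r a • P a)).unique ?_
  simp only [hpow, Finset.smul_sum, smul_smul]
  refine hasSum_sum fun a _ => ?_
  have h2 := NormedSpace.exp_series_hasSum_exp' (𝕂 := ℝ) (r a)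
  rw [← Real.exp_eq_exp_ℝ] at h2
  exact h2.smul_const (P a)

end LieTrotter

/-! ### Ordered products of exponentials -/

section ExpProd

variable {R : Type*} [NormedRing R] [NormedAlgebra ℝ R]

theorem expProd_congr (K : R) {B B' : ℕ → R} {n : ℕ} (h : ∀ i < n, B i = B' i)
    (p : Fin (n + 1) → ℝ) : expProd K B n p = expProd K B' n p := by
  induction n with
  | zero => rfl
  | succ n ih =>
    rw [expProd, expProd, h n n.lt_succ_self, ih fun i hi => h i (hi.trans n.lt_succ_self)]

/-- The product is linear in each slot. Only the first `n` slots are read, so `default` never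
contributes. -/
theorem sum_prod_smul_expProd {S : Type*} [Fintype S] [Inhabited S] (K : R) (P : S → R)
    (r : S → ℝ) (n : ℕ) (p : Fin (n + 1) → ℝ) :
    ∑ a : Fin n → S, (∏ i, r (a i)) •
        expProd K (fun i => P (if h : i < n then a ⟨i, h⟩ else default)) n p =
      expProd K (fun _ => ∑ s, r s • P s) n p := by
  induction n with
  | zero => simp [expProd]
  | succ n ih =>
    rw [← (Fin.snocEquiv fun _ : Fin (n + 1) => S).sum_comp, Fintype.sum_prod_type]
    simp only [expProd]
    rw [← ih, Finset.mul_sum (Finset.univ : Finset S), Finset.sum_mul]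
    refine Finset.sum_congr rfl fun s _ => ?_
    rw [Finset.mul_sum]
    refine Finset.sum_congr rfl fun a _ => ?_
    rw [Fin.prod_univ_castSucc]
    have h1 : expProd K (fun i => P (if h : i < n + 1 then
        (Fin.snocEquiv (fun _ : Fin (n + 1) => S) (s, a) : Fin (n + 1) → S) ⟨i, h⟩ else default)) n
        (Fin.init p) =
        expProd K (fun i => P (if h : i < n then a ⟨i, h⟩ else default)) n (Fin.init p) := by
      refine expProd_congr K (fun i hi => ?_) _
      rw [dif_pos hi, dif_pos (hi.trans n.lt_succ_self)]
      congr 1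
      exact Fin.snoc_castSucc (α := fun _ => S) s a ⟨i, hi⟩
    rw [h1, dif_pos n.lt_succ_self]
    simp only [Fin.snocEquiv, Equiv.coe_fn_mk]
    have h2 : (⟨n, n.lt_succ_self⟩ : Fin (n + 1)) = Fin.last n := rfl
    rw [h2]
    simp only [Fin.snoc_castSucc, Fin.snoc_last]
    simp only [mul_smul_comm, smul_mul_assoc, smul_smul]

theorem expProd_const (K M : R) {n : ℕ} {p : Fin (n + 1) → ℝ} {c : ℝ}
    (hp : ∀ i : Fin n, p i.castSucc = c) :
    expProd K (fun _ => M) n p =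
      NormedSpace.exp (p (Fin.last n) • K) * (M * NormedSpace.exp (c • K)) ^ n := by
  induction n with
  | zero => simp [expProd]
  | succ n ih =>
    rw [expProd, ih (p := Fin.init p) fun i => hp i.castSucc, pow_succ']
    have : Fin.init p (Fin.last n) = c := hp (Fin.last n)
    rw [this]
    simp only [mul_assoc]

theorem expProd_eq_list_prod (K : R) (B : ℕ → R) (n : ℕ) (p : Fin (n + 1) → ℝ) :
    expProd K B n p = NormedSpace.exp (p (Fin.last n) • K) *
      (List.ofFn fun i : Fin n => B i * NormedSpace.exp (p i.castSucc • K)).reverse.prod := by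
  induction n with
  | zero => simp [expProd]
  | succ n ih =>
    rw [expProd, ih, List.ofFn_succ_last]
    simp [Fin.init, mul_assoc]

end ExpProd

/-! ### The Feynman–Kac formula for the path measure -/

section RiemannIntegral

variable {R S : Type*} [NormedRing R] [NormedAlgebra ℝ R] [CompleteSpace R] [EMetricSpace S]
  [Fintype S]

omit [NormedAlgebra ℝ R] [CompleteSpace R] [EMetricSpace S] in
theorem projSum_singleton (P : S → R) (s : S) : projSum P {s} = P s := by
  rw [projSum, Finset.sum_eq_single s]
  · simp
  · intro b _ hb
    simp [hb]
  · simp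

theorem gap_node_castSucc (n : ℕ) (i : Fin (n + 1)) :
    gap (fun j => (node n j : ℝ)) i.castSucc = ((n : ℝ) + 1)⁻¹ := by
  rw [gap, Fin.snoc_castSucc]
  rcases Fin.eq_zero_or_eq_succ i with rfl | ⟨j, rfl⟩
  · simp [node]
  · rw [← Fin.succ_castSucc, Fin.cons_succ]
    simp only [node, Fin.val_succ, Fin.val_castSucc]
    push_cast
    rw [div_sub_div_same, add_sub_cancel_left, one_div]

/-- Since the last node is `1`, the leftmost exponential is trivial and the operator product becomes
an exact power. -/
theorem gap_node_last (n : ℕ) : gap (fun j => (node n j : ℝ)) (Fin.last (n + 1)) = 0 := by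
  rw [gap, Fin.snoc_last, ← Fin.succ_last, Fin.cons_succ]
  simp only [node, Fin.val_last]
  rw [div_self (by positivity), sub_self]

theorem exp_riemannSum (f : S → ℝ) (n : ℕ) (η : SkorokhodSpace S) :
    Real.exp (riemannSum f n η) = ∑ a : Fin (n + 1) → S,
      Set.indicator {ξ : SkorokhodSpace S | ∀ i, ξ (node n i) = a i}
        (fun _ => ∏ i, Real.exp (((n : ℝ) + 1)⁻¹ * f (a i))) η := by
  rw [Finset.sum_eq_single fun i => η (node n i)]
  · rw [Set.indicator_of_mem (by simp), ← Real.exp_sum, riemannSum]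
    simp only [div_eq_inv_mul]
  · intro a _ ha
    refine Set.indicator_of_notMem (fun h => ha ?_) _
    exact (funext h).symm
  · simp

theorem measurableSet_setOf_nodes (n : ℕ) (a : Fin (n + 1) → S) :
    MeasurableSet {ξ : SkorokhodSpace S | ∀ i, ξ (node n i) = a i} :=
  measurableSet_setOf_forall_eval_mem (node n) fun i => {a i}

theorem integral_exp_riemannSum [Inhabited S] (P : S → R) (K : R) (τ : R →L[ℝ] ℂ)
    (h1 : ∑ a, P a = 1) (hP : ∀ a, P a * P a = P a) (hP' : ∀ a b, a ≠ b → P a * P b = 0)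
    (f : S → ℝ) (n : ℕ) :
    ∫ᵛ η, Real.exp (riemannSum f n η) ∂•(dysonMeasure P K τ) =
      τ ((NormedSpace.exp (((n : ℝ) + 1)⁻¹ • ∑ s, f s • P s) *
        NormedSpace.exp (((n : ℝ) + 1)⁻¹ • K)) ^ (n + 1)) := by
  have hfin : IsFiniteMeasure (dysonMeasure P K τ).variation :=
    (isBoundedRadon_dysonMeasure P K τ).finite
  simp only [exp_riemannSum]
  rw [VectorMeasure.integral_finsetSum _ fun a _ =>
    (integrable_const _).indicator (measurableSet_setOf_nodes n a)]
  have hval : ∀ a : Fin (n + 1) → S,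
      dysonMeasure P K τ {ξ : SkorokhodSpace S | ∀ i, ξ (node n i) = a i} =
        τ (expProd K (fun i => P (if h : i < n + 1 then a ⟨i, h⟩ else default)) (n + 1)
          (gap fun i => (node n i : ℝ))) := fun a => by
    have hset : {ξ : SkorokhodSpace S | ∀ i, ξ (node n i) = a i} =
        {ξ | ∀ i : Fin (n + 1), ξ (node n i) ∈
          ({if h : (i : ℕ) < n + 1 then a ⟨i, h⟩ else default} : Set S)} := by
      simp only [Fin.is_lt, dite_true, Fin.eta, Set.mem_singleton_iff]
    have h2 := dysonMeasure_setOf_eval P K τ h1 hP hP' (node_strictMono n)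
      (fun i => {if h : i < n + 1 then a ⟨i, h⟩ else default})
      (hset ▸ measurableSet_setOf_nodes n a)
    rw [← hset] at h2
    simpa only [projSum_singleton] using h2
  have hterm : ∀ a : Fin (n + 1) → S,
      ∫ᵛ η, Set.indicator {ξ : SkorokhodSpace S | ∀ i, ξ (node n i) = a i}
        (fun _ => ∏ i, Real.exp (((n : ℝ) + 1)⁻¹ * f (a i))) η ∂•(dysonMeasure P K τ) =
      τ ((∏ i, Real.exp (((n : ℝ) + 1)⁻¹ * f (a i))) •
        expProd K (fun i => P (if h : i < n + 1 then a ⟨i, h⟩ else default)) (n + 1)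
          (gap fun i => (node n i : ℝ))) := fun a => by
    rw [VectorMeasure.integral_indicator_const _ (measurableSet_setOf_nodes n a), hval, map_smul]
    rfl
  rw [Finset.sum_congr rfl fun a _ => hterm a, ← map_sum,
    sum_prod_smul_expProd K P (fun s => Real.exp (((n : ℝ) + 1)⁻¹ * f s)),
    expProd_const K _ (gap_node_castSucc n), gap_node_last, zero_smul, NormedSpace.exp_zero,
    one_mul, ← exp_sum_smul_of_orthogonal P h1 hP hP', Finset.smul_sum]
  simp only [smul_smul]

theorem measurable_integral_comp_path (f : S → ℝ) :
    Measurable fun η : SkorokhodSpace S => ∫ t : I, f (η t) :=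
  measurable_of_tendsto_metrizable (fun n => measurable_riemannSum f n)
    (tendsto_pi_nhds.2 fun η => tendsto_riemannSum f η)

theorem integrable_exp_integral (μ : Measure (SkorokhodSpace S)) [IsFiniteMeasure μ] (f : S → ℝ) :
    Integrable (fun η : SkorokhodSpace S => Real.exp (∫ t : I, f (η t))) μ := by
  obtain ⟨C, hC⟩ := exists_forall_abs_le f
  refine .of_bound (measurable_integral_comp_path f).exp.aestronglyMeasurable (Real.exp C)
    (.of_forall fun η => ?_)
  rw [Real.norm_of_nonneg (Real.exp_pos _).le, Real.exp_le_exp]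
  refine le_of_tendsto' (tendsto_riemannSum f η) fun n => ?_
  exact (le_abs_self _).trans (abs_riemannSum_le hC n η)

/-- The integrals of the Riemann-sum exponentials have two limits, one by dominated convergence and
one by the Lie product formula, which must coincide. -/
theorem integral_exp_integral [Inhabited S] [NormOneClass R] (P : S → R) (K : R) (τ : R →L[ℝ] ℂ)
    (h1 : ∑ a, P a = 1) (hP : ∀ a, P a * P a = P a) (hP' : ∀ a b, a ≠ b → P a * P b = 0)
    (f : S → ℝ) :
    ∫ᵛ η, Real.exp (∫ t : I, f (η t)) ∂•(dysonMeasure P K τ) =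
      τ (NormedSpace.exp (∑ s, f s • P s + K)) := by
  have hfin : IsFiniteMeasure (dysonMeasure P K τ).variation :=
    (isBoundedRadon_dysonMeasure P K τ).finite
  obtain ⟨C, hC⟩ := exists_forall_abs_le f
  have hlim : Tendsto (fun n => ∫ᵛ η, Real.exp (riemannSum f n η) ∂•(dysonMeasure P K τ)) atTop
      (𝓝 (∫ᵛ η, Real.exp (∫ t : I, f (η t)) ∂•(dysonMeasure P K τ))) :=
    VectorMeasure.tendsto_integral_filter_of_norm_le_const
      (.of_forall fun n => (measurable_riemannSum f n).exp.aestronglyMeasurable)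
      ⟨Real.exp C, .of_forall fun n => .of_forall fun η => by
        rw [Real.norm_of_nonneg (Real.exp_pos _).le, Real.exp_le_exp]
        exact (le_abs_self _).trans (abs_riemannSum_le hC n η)⟩
      (.of_forall fun η => (Real.continuous_exp.tendsto _).comp (tendsto_riemannSum f η))
  refine tendsto_nhds_unique hlim ?_
  simp only [integral_exp_riemannSum P K τ h1 hP hP']
  exact (τ.continuous.tendsto _).comp (tendsto_exp_mul_exp_pow _ K)

end RiemannIntegral

/-! ### Spectral projections of a Hermitian matrix -/

section SpectralProjection

variable {m : ℕ} {X : Matrix (Fin m) (Fin m) ℂ}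

/-- Finiteness of the spectrum admits indicator functions to the continuous functional calculus. -/
theorem continuousOn_spectrum (X : Matrix (Fin m) (Fin m) ℂ) (f : ℝ → ℝ) :
    ContinuousOn f (spectrum ℝ X) :=
  (Set.toFinite (spectrum ℝ X)).continuousOn f

theorem spectralProj_mul (A B : Set (spectrum ℝ X)) :
    spectralProj X A * spectralProj X B = spectralProj X (A ∩ B) := by
  rw [spectralProj, spectralProj, spectralProj, ← cfc_mul _ _ X (continuousOn_spectrum X _)
    (continuousOn_spectrum X _)]
  refine cfc_congr fun x _ => ?_
  rw [Set.image_inter Subtype.val_injective]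
  by_cases hA : x ∈ Subtype.val '' A <;> by_cases hB : x ∈ Subtype.val '' B <;>
    simp only [Set.indicator, Set.mem_inter_iff, hA, hB] <;> simp

theorem spectralProj_univ (hX : X.IsHermitian) : spectralProj X Set.univ = 1 := by
  rw [spectralProj, ← cfc_one ℝ X hX.isSelfAdjoint]
  refine cfc_congr fun x hx => ?_
  simp [hx]

theorem spectralProj_empty : spectralProj X ∅ = 0 := by
  simp [spectralProj]

theorem cfc_eq_sum_spectralProj [Fintype (spectrum ℝ X)] (f : ℝ → ℝ) :
    cfc f X = ∑ s : spectrum ℝ X, f s • spectralProj X {s} := by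
  simp only [spectralProj]
  simp only [← cfc_smul _ _ X (continuousOn_spectrum X _)]
  rw [← cfc_sum_univ _ X fun _ => continuousOn_spectrum X _]
  refine cfc_congr fun x hx => ?_
  rw [Finset.sum_apply, Finset.sum_eq_single ⟨x, hx⟩]
  · simp
  · intro s _ hs
    have : x ≠ s := fun h => hs (Subtype.ext h.symm)
    simp [this]
  · simp

theorem projSum_spectralProj [Fintype (spectrum ℝ X)] (A : Set (spectrum ℝ X)) :
    projSum (fun s => spectralProj X {s}) A = spectralProj X A := by
  classical
  have h := cfc_eq_sum_spectralProj (X := X) (Set.indicator (Subtype.val '' A) fun _ => (1 : ℝ))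
  rw [spectralProj, h, projSum]
  refine Finset.sum_congr rfl fun s _ => ?_
  by_cases hs : s ∈ A <;> simp [hs]

end SpectralProjection

/-! ### Specialisation to matrices and the trace -/

section Matrix

open scoped Matrix.Norms.Operator

variable {m : ℕ}

/-- The trace as a continuous real-linear functional. -/
noncomputable def traceL (m : ℕ) : Matrix (Fin m) (Fin m) ℂ →L[ℝ] ℂ :=
  LinearMap.toContinuousLinearMap (Matrix.traceLinearMap (Fin m) ℝ ℂ)

theorem pathProduct_eq_expProd (X H : Matrix (Fin m) (Fin m) ℂ) {n : ℕ} (t : Fin (n + 1) → ℝ)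
    (A : ℕ → Set (spectrum ℝ X)) :
    pathProduct X H t (fun i => A i) =
      expProd (-H) (fun i => spectralProj X (A i)) (n + 1) (gap t) := by
  rw [expProd_eq_list_prod, pathProduct]
  simp only [semigroup, smul_neg, gap, Fin.snoc_castSucc, Fin.snoc_last]
  congr 1

end Matrix

end QSP

theorem mainTheorem4 (m : ℕ) (X H : Matrix (Fin m) (Fin m) ℂ)
    (hX : X.IsHermitian) (hH : H.IsHermitian) :
    ∃ κ : ComplexMeasure (QSP.SkorokhodSpace (spectrum ℝ X)),
      QSP.IsBoundedRadon κ ∧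
      (∀ (n : ℕ) (t : Fin (n + 1) → unitInterval) (A : Fin (n + 1) → Set (spectrum ℝ X)),
        StrictMono t → (∀ i, MeasurableSet (A i)) →
          MeasurableSet {ξ : QSP.SkorokhodSpace (spectrum ℝ X) | ∀ i, ξ (t i) ∈ A i} ∧
          κ {ξ : QSP.SkorokhodSpace (spectrum ℝ X) | ∀ i, ξ (t i) ∈ A i} =
            (QSP.pathProduct X H (fun i => (t i : ℝ)) A).trace) ∧
      (∀ f : ℝ → ℝ, ContinuousOn f (spectrum ℝ X) →
        (∀ η : QSP.SkorokhodSpace (spectrum ℝ X),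
          Integrable (fun t : unitInterval => f (η t)) volume) ∧
        Integrable (fun η : QSP.SkorokhodSpace (spectrum ℝ X) =>
          Real.exp (∫ t : unitInterval, f (η t))) κ.variation ∧
        (NormedSpace.exp (cfc f X - H)).trace =
          ∫ᵛ η : QSP.SkorokhodSpace (spectrum ℝ X),
            Real.exp (∫ t : unitInterval, f (η t)) ∂•κ) := by
  open scoped Matrix.Norms.Operator in
  have := Fintype.ofFinite (spectrum ℝ X)
  have h1 : ∑ s : spectrum ℝ X, QSP.spectralProj X {s} = 1 := by
    rw [← QSP.spectralProj_univ hX, ← QSP.projSum_spectralProj]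
    simp [QSP.projSum]
  have hP : ∀ s : spectrum ℝ X, QSP.spectralProj X {s} * QSP.spectralProj X {s} =
      QSP.spectralProj X {s} := fun s => by
    rw [QSP.spectralProj_mul, Set.inter_self]
  have hP' : ∀ s s' : spectrum ℝ X, s ≠ s' →
      QSP.spectralProj X {s} * QSP.spectralProj X {s'} = 0 := fun s s' h => by
    rw [QSP.spectralProj_mul, Set.singleton_inter_eq_empty.2 (by simpa using h),
      QSP.spectralProj_empty]
  have hfin := (QSP.isBoundedRadon_dysonMeasure
    (fun s : spectrum ℝ X => QSP.spectralProj X {s}) (-H) (QSP.traceL m)).finite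
  refine ⟨QSP.dysonMeasure (fun s : spectrum ℝ X => QSP.spectralProj X {s}) (-H) (QSP.traceL m),
    QSP.isBoundedRadon_dysonMeasure _ _ _, fun n t A ht _ => ?_, fun f _ => ?_⟩
  · have hm := QSP.measurableSet_setOf_forall_eval_mem t A
    refine ⟨hm, ?_⟩
    -- The recursive products index their factors by `ℕ`; the value `∅` past `n` is never read.
    obtain ⟨A', rfl⟩ : ∃ A' : ℕ → Set (spectrum ℝ X), A = fun i : Fin (n + 1) => A' i :=
      ⟨fun i => if h : i < n + 1 then A ⟨i, h⟩ else ∅, by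
        simp only [Fin.is_lt, dite_true, Fin.eta]⟩
    refine (QSP.dysonMeasure_setOf_eval (fun s : spectrum ℝ X => QSP.spectralProj X {s}) (-H)
      (QSP.traceL m) h1 hP hP' ht A' hm).trans ?_
    simp only [QSP.projSum_spectralProj, QSP.pathProduct_eq_expProd]
    rfl
  · refine ⟨QSP.integrable_comp_path fun s : spectrum ℝ X => f s,
      QSP.integrable_exp_integral _ fun s : spectrum ℝ X => f s, ?_⟩
    -- For `m = 0` the spectrum and the path space are empty and both sides vanish. Otherwise the
    -- spectrum is nonempty, since an empty sum of projections is not `1`.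
    rcases Nat.eq_zero_or_pos m with rfl | hpos
    · have : IsEmpty (QSP.SkorokhodSpace (spectrum ℝ X)) := ⟨fun η => by
        exact (spectrum.of_subsingleton (R := ℝ) X).le (η 0).2⟩
      rw [VectorMeasure.integral_of_isEmpty]
      simp [Matrix.trace]
    · have : Nonempty (Fin m) := ⟨⟨0, hpos⟩⟩
      have : Inhabited (spectrum ℝ X) := by
        refine Classical.inhabited_of_nonempty (not_isEmpty_iff.1 fun h => ?_)
        simp at h1
      rw [sub_eq_add_neg, QSP.cfc_eq_sum_spectralProj f]
      exact (QSP.integral_exp_integral (fun s : spectrum ℝ X => QSP.spectralProj X {s}) (-H)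
        (QSP.traceL m) h1 hP hP' fun s : spectrum ℝ X => f s).symm
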